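/- Let $n\ge 1$, $p\ge 0$ and let $f_1,\dots,f_n:\mathbb R^p\to\mathbb R$ be continuously differentiable with $\|\nabla f_i(x)-\nabla f_i(u)\|\le L\|x-u\|$ for all $x,u$, where $L>0$. Let $f=\frac1n\sum_i f_i$ satisfy $\langle\nabla f(x)-\nabla f(u),x-u\rangle\ge\mu\|x-u\|^2$ for all $x,u$, where $\mu>0$, and let $x^*$ be the minimizer of $f$ over $\mathbb R^p$. For $k\ge0$ let $\mathbb G_k=([n],\mathcal E_k)$ be a strongly connected directed graph, $A_k$ a row-stochastic and $B_k$ a column-stochastic $n\times n$ matrix such that $[A_k]_{ij}$ and $[B_k]_{ij}$ are positive if $(j,i)\in\mathcal E_k$ or $i=j$, and are zero otherwise. Let $a,b>0$ be such that all positive entries of every $A_k$ are at least $a$ and all positive entries of every $B_k$ are at least $b$. Let $\{\phi_k\}_{k\ge0}$ be stochastic vectors with $\phi_{k+1}^{\mathsf T}A_k=\phi_k^{\mathsf T}$ for all $k\ge0$, and let $\pi_0=\frac1n\mathbf 1$, $\pi_{k+1}=B_k\pi_k$. Let $0<\alpha<\frac{2}{nL}$ and $\beta,\gamma\ge0$.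 Given arbitrary $x_{-1}^i,x_0^i,s_0^i\in\mathbb R^p$ and $y_0^i=\nabla f_i(s_0^i)$, $i\in[n]$, let for all $k\ge0$ $$x_{k+1}^i=\sum_{j}[A_k]_{ij}s_k^j-\alpha y_k^i+\beta(x_k^i-x_{k-1}^i),\quad s_{k+1}^i=x_{k+1}^i+\gamma(x_{k+1}^i-x_k^i),\quad y_{k+1}^i=\sum_j[B_k]_{ij}y_k^j+\nabla f_i(s_{k+1}^i)-\nabla f_i(s_k^i).$$ Put $\hat x_k=\sum_i[\phi_k]_ix_k^i$, $\mathbf x_k=(x_k^1,\dots,x_k^n)$ with $\|\mathbf x_k\|^2=\sum_i\|x_k^i\|^2$, $$D_k=\sqrt{\sum_i[\phi_k]_i\|x_k^i-\hat x_k\|^2},\quad S_k=\sqrt{\sum_j[\pi_k]_j\Big\|\frac{y_k^j}{[\pi_k]_j}-\sum_\ell y_k^\ell\Big\|^2},\quad V_k=\big(\|\hat x_k-x^*\|,\,D_k,\,S_k,\,\|\mathbf x_k-\mathbf x_{k-1}\|\big)^{\mathsf T}.$$ Let $\mathsf D(\mathbb G)$ be the diameter of $\mathbb G$, i.e. the largest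 length of a shortest directed path between two distinct nodes. Let $\mathsf K(\mathbb G)$ be the maximum, over all choices of one shortest directed path for each ordered pair of distinct nodes and over all edges of $\mathbb G$, of the number of chosen paths that pass through the edge. With $\min(v),\max(v)$ the smallest and largest entries of $v$, put $$\varphi_k=\sqrt{\tfrac1{\min(\phi_k)}},\qquad r_k=\sqrt n+\tfrac1{\sqrt{\min(\pi_{k+1})}},\qquad c_k=\sqrt{1-\tfrac{\min(\phi_{k+1})\,a^2}{\max^2(\phi_k)\,\mathsf D(\mathbb G_k)\mathsf K(\mathbb G_k)}},$$ $$\tau_k=\sqrt{1-\tfrac{\min^2(\pi_k)\,b^2}{\max^2(\pi_k)\max(\pi_{k+1})\,\mathsf D(\mathbb G_k)\mathsf K(\mathbb G_k)}},\qquad q_k(\alpha)=\max\{|1-\alpha n\min(\pi_k)\mu|,\,|1-\alpha n\min(\pi_k)L|\}$$ (for $n=1$, where there are no pairs of distinct nodes, $c_k=\tau_k=1$). Let $M_k=M_k(\alpha,\beta,\gamma)=(m_k^{i,j})$ be the $4\times4$ matrix with \begin{align*} &m_k^{1,1}=q_k(\alpha),\quad m_k^{1,2}=\alpha L\sqrt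 n\,\varphi_k,\quad m_k^{1,3}=\alpha,\quad m_k^{1,4}=\beta+\gamma(1+\alpha L\sqrt n),\\ &m_k^{2,1}=\alpha L\sqrt n\,\varphi_k,\quad m_k^{2,2}=c_k+\alpha L\sqrt n\,\varphi_k,\quad m_k^{2,3}=\alpha,\quad m_k^{2,4}=\beta+\gamma(c_k+\alpha L\sqrt n),\\ &m_k^{3,1}=Lr_k(1+\gamma)m_k^{4,1},\quad m_k^{3,2}=Lr_k(1+\gamma)m_k^{4,2},\\ &m_k^{3,3}=\tau_k+Lr_k(1+\gamma)m_k^{4,3},\quad m_k^{3,4}=Lr_k\gamma+Lr_k(1+\gamma)m_k^{4,4},\\ &m_k^{4,1}=\alpha L\sqrt n\,\varphi_k,\quad m_k^{4,2}=c_k\varphi_{k+1}+\varphi_k+\alpha L\sqrt n\,\varphi_k,\quad m_k^{4,3}=\alpha,\quad m_k^{4,4}=\beta+\gamma\sqrt n(1+\alpha L). \end{align*} Then $V_{k+1}\le M_k(\alpha,\beta,\gamma)V_k$ entrywise for all $k\ge1$; if moreover $s_0^i=x_0^i+\gamma(x_0^i-x_{-1}^i)$ for all $i\in[n]$, the inequality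 also holds for $k=0$. -/

import Mathlib

open scoped Matrix

namespace ABPushPull

/-! ### Directed graphs: paths, diameter, maximal edge-utility -/

/-- `p` is the list of the (distinct) nodes visited by a directed path from `j` to `l`. -/
def IsDirPath {n : ℕ} (G : Digraph (Fin n)) (j l : Fin n) (p : List (Fin n)) : Prop :=
  p.head? = some j ∧ p.getLast? = some l ∧ p.IsChain G.Adj ∧ p.Nodup

/-- The number of edges of a path given by its list of nodes. -/
def pathLength {n : ℕ} (p : List (Fin n)) : ℕ := p.length - 1

/-- There is a directed path from any node to all other nodes. -/
def StronglyConnected {n : ℕ} (G : Digraph (Fin n)) : Prop :=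
  ∀ j l : Fin n, j ≠ l → ∃ p, IsDirPath G j l p

/-- `p` is a shortest directed path from `j` to `l`. -/
def IsShortestPath {n : ℕ} (G : Digraph (Fin n)) (j l : Fin n) (p : List (Fin n)) : Prop :=
  IsDirPath G j l p ∧ ∀ q, IsDirPath G j l q → pathLength p ≤ pathLength q

/-- The length of the longest among all shortest directed paths between ordered pairs of
distinct nodes. -/
noncomputable def diameter {n : ℕ} (G : Digraph (Fin n)) : ℕ :=
  sSup {m | ∃ j l p, j ≠ l ∧ IsShortestPath G j l p ∧ m = pathLength p}

/-- A shortest-path covering: a choice of one shortest directed path `P j l` for every ordered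
pair of distinct nodes (the values `P j j` play no role). -/
def IsCovering {n : ℕ} (G : Digraph (Fin n)) (P : Fin n → Fin n → List (Fin n)) : Prop :=
  ∀ j l : Fin n, j ≠ l → IsShortestPath G j l (P j l)

/-- The number of paths of the covering `P` that pass through the edge `(u, v)`. -/
noncomputable def edgeUtility {n : ℕ} (P : Fin n → Fin n → List (Fin n)) (u v : Fin n) : ℕ :=
  Set.ncard {e : Fin n × Fin n | e.1 ≠ e.2 ∧ [u, v] <:+: P e.1 e.2}

/-- The maximum edge-utility of a covering, over all edges of the graph. -/
noncomputable def coveringUtility {n : ℕ} (G : Digraph (Fin n))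
    (P : Fin n → Fin n → List (Fin n)) : ℕ :=
  sSup {m | ∃ u v, G.Adj u v ∧ m = edgeUtility P u v}

/-- The maximal edge-utility of the graph, over all shortest-path coverings. -/
noncomputable def maxEdgeUtility {n : ℕ} (G : Digraph (Fin n)) : ℕ :=
  sSup {m | ∃ P, IsCovering G P ∧ m = coveringUtility G P}

/-! ### Weight matrices aligned with a graph -/

/-- `[A]_{ij}` is positive if `j` is an in-neighbor of `i` or `j = i`, and zero otherwise. -/
def AlignedA {n : ℕ} (G : Digraph (Fin n)) (A : Matrix (Fin n) (Fin n) ℝ) : Prop :=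
  ∀ i j : Fin n,
    ((G.Adj j i ∨ j = i) → 0 < A i j) ∧ (¬ (G.Adj j i ∨ j = i) → A i j = 0)

/-- `[B]_{ji}` is positive if `j` is an out-neighbor of `i` or `j = i`, and zero otherwise. -/
def AlignedB {n : ℕ} (G : Digraph (Fin n)) (B : Matrix (Fin n) (Fin n) ℝ) : Prop :=
  ∀ i j : Fin n,
    ((G.Adj i j ∨ j = i) → 0 < B j i) ∧ (¬ (G.Adj i j ∨ j = i) → B j i = 0)

/-- The communication network: strongly connected digraphs `G k`, row-stochastic matrices `A k`
and column-stochastic matrices `B k` aligned with `G k`, with positive entries bounded below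
by `a > 0` and `b > 0` respectively. -/
structure IsNetwork {n : ℕ} (G : ℕ → Digraph (Fin n)) (A B : ℕ → Matrix (Fin n) (Fin n) ℝ)
    (a b : ℝ) : Prop where
  strong : ∀ k, StronglyConnected (G k)
  row : ∀ k, A k ∈ Matrix.rowStochastic ℝ (Fin n)
  col : ∀ k, B k ∈ Matrix.colStochastic ℝ (Fin n)
  alignA : ∀ k, AlignedA (G k) (A k)
  alignB : ∀ k, AlignedB (G k) (B k)
  a_pos : 0 < a
  b_pos : 0 < b
  a_le : ∀ k i j, 0 < A k i j → a ≤ A k i j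
  b_le : ∀ k i j, 0 < B k i j → b ≤ B k i j

/-- `φ` is a sequence of stochastic vectors with `φ_{k+1}ᵀ A_k = φ_kᵀ`. -/
def IsAbsProbSeq {n : ℕ} (A : ℕ → Matrix (Fin n) (Fin n) ℝ) (φ : ℕ → Fin n → ℝ) : Prop :=
  (∀ k, φ k ∈ stdSimplex ℝ (Fin n)) ∧ ∀ k, φ (k + 1) ᵥ* A k = φ k

/-- `π_0 = (1/n) 𝟏` and `π_{k+1} = B_k π_k`. -/
noncomputable def piSeq {n : ℕ} (B : ℕ → Matrix (Fin n) (Fin n) ℝ) : ℕ → Fin n → ℝ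
  | 0 => fun _ => 1 / (n : ℝ)
  | k + 1 => B k *ᵥ piSeq B k

/-! ### The optimization problem -/

/-- The global cost `f = (1/n) ∑ f_i`. -/
noncomputable def avgFun {n p : ℕ} (f : Fin n → EuclideanSpace ℝ (Fin p) → ℝ)
    (x : EuclideanSpace ℝ (Fin p)) : ℝ :=
  (1 / (n : ℝ)) * ∑ i, f i x

/-- Each `f i` is continuously differentiable with `L`-Lipschitz gradient. -/
def SmoothCosts {n p : ℕ} (f : Fin n → EuclideanSpace ℝ (Fin p) → ℝ) (L : ℝ) : Prop :=
  ∀ i, ContDiff ℝ 1 (f i) ∧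
    ∀ x u, ‖gradient (f i) x - gradient (f i) u‖ ≤ L * ‖x - u‖

/-- The average `f` is `μ`-strongly convex, in gradient form. -/
def StronglyConvexAvg {n p : ℕ} (f : Fin n → EuclideanSpace ℝ (Fin p) → ℝ) (μ : ℝ) : Prop :=
  ∀ x u, μ * ‖x - u‖ ^ 2 ≤ inner ℝ (gradient (avgFun f) x - gradient (avgFun f) u) (x - u)

/-! ### The accelerated AB/Push-Pull iterates -/

/-- The state at time `k`: `xPrev = x_{k-1}`, `x = x_k`, `s = s_k`, `y = y_k`. -/
structure State (n p : ℕ) where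
  xPrev : Fin n → EuclideanSpace ℝ (Fin p)
  x : Fin n → EuclideanSpace ℝ (Fin p)
  s : Fin n → EuclideanSpace ℝ (Fin p)
  y : Fin n → EuclideanSpace ℝ (Fin p)

/-- `x_{k+1}^i = ∑_j [A_k]_{ij} s_k^j - α y_k^i + β (x_k^i - x_{k-1}^i)`. -/
noncomputable def nextX {n p : ℕ} (A : Matrix (Fin n) (Fin n) ℝ) (α β : ℝ) (σ : State n p) :
    Fin n → EuclideanSpace ℝ (Fin p) :=
  fun i => ∑ j, A i j • σ.s j - α • σ.y i + β • (σ.x i - σ.xPrev i)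

/-- `s_{k+1}^i = x_{k+1}^i + γ (x_{k+1}^i - x_k^i)`. -/
noncomputable def nextS {n p : ℕ} (A : Matrix (Fin n) (Fin n) ℝ) (α β γ : ℝ) (σ : State n p) :
    Fin n → EuclideanSpace ℝ (Fin p) :=
  fun i => nextX A α β σ i + γ • (nextX A α β σ i - σ.x i)

/-- `y_{k+1}^i = ∑_j [B_k]_{ij} y_k^j + ∇f_i(s_{k+1}^i) - ∇f_i(s_k^i)`. -/
noncomputable def nextY {n p : ℕ} (f : Fin n → EuclideanSpace ℝ (Fin p) → ℝ)
    (A B : Matrix (Fin n) (Fin n) ℝ) (α β γ : ℝ) (σ : State n p) :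
    Fin n → EuclideanSpace ℝ (Fin p) :=
  fun i => ∑ j, B i j • σ.y j + gradient (f i) (nextS A α β γ σ i) - gradient (f i) (σ.s i)

/-- The iterates started from `x_{-1}`, `x_0`, `s_0` and `y_0^i = ∇f_i(s_0^i)`. -/
noncomputable def iter {n p : ℕ} (f : Fin n → EuclideanSpace ℝ (Fin p) → ℝ)
    (A B : ℕ → Matrix (Fin n) (Fin n) ℝ) (α β γ : ℝ)
    (xInit x0 s0 : Fin n → EuclideanSpace ℝ (Fin p)) : ℕ → State n p
  | 0 => ⟨xInit, x0, s0, fun i => gradient (f i) (s0 i)⟩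
  | k + 1 =>
    let σ := iter f A B α β γ xInit x0 s0 k
    ⟨σ.x, nextX (A k) α β σ, nextS (A k) α β γ σ, nextY f (A k) (B k) α β γ σ⟩

/-! ### The four error quantities -/

/-- `‖z‖_w = √(∑ w_i ‖z_i‖²)`. -/
noncomputable def wnorm {n p : ℕ} (w : Fin n → ℝ) (z : Fin n → EuclideanSpace ℝ (Fin p)) : ℝ :=
  √(∑ i, w i * ‖z i‖ ^ 2)

/-- The weighted average `∑ w_i x_i`. -/
noncomputable def wavg {n p : ℕ} (w : Fin n → ℝ) (x : Fin n → EuclideanSpace ℝ (Fin p)) :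
    EuclideanSpace ℝ (Fin p) :=
  ∑ i, w i • x i

/-- The consensus error `D(x, φ)`. -/
noncomputable def consErr {n p : ℕ} (x : Fin n → EuclideanSpace ℝ (Fin p)) (φ : Fin n → ℝ) : ℝ :=
  wnorm φ (fun i => x i - wavg φ x)

/-- The gradient-tracking error `S(y, π)`. -/
noncomputable def trackErr {n p : ℕ} (y : Fin n → EuclideanSpace ℝ (Fin p)) (π : Fin n → ℝ) : ℝ :=
  wnorm π (fun j => (π j)⁻¹ • y j - ∑ l, y l)

/-- `V = (‖x̂ - x*‖, D(x, φ), S(y, π), ‖x - xPrev‖)`. -/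
noncomputable def errVec {n p : ℕ} (σ : State n p) (φ π : Fin n → ℝ)
    (xStar : EuclideanSpace ℝ (Fin p)) : Fin 4 → ℝ :=
  ![‖wavg φ σ.x - xStar‖, consErr σ.x φ, trackErr σ.y π, wnorm 1 (fun i => σ.x i - σ.xPrev i)]

/-! ### The constants and the matrix `M_k` -/

/-- The smallest entry of a vector. -/
noncomputable def vmin {n : ℕ} (v : Fin n → ℝ) : ℝ := ⨅ i, v i

/-- The largest entry of a vector. -/
noncomputable def vmax {n : ℕ} (v : Fin n → ℝ) : ℝ := ⨆ i, v i

/-- `φ ↦ √(1 / min φ)`. -/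
noncomputable def varphiC {n : ℕ} (φ : Fin n → ℝ) : ℝ := √(1 / vmin φ)

/-- `r_k`, as a function of `π_{k+1}`. -/
noncomputable def rC {n : ℕ} (πNext : Fin n → ℝ) : ℝ := √(n : ℝ) + 1 / √(vmin πNext)

/-- `c_k`, as a function of `𝔾_k`, `a`, `φ_k` and `φ_{k+1}`. For `n = 1` the denominator is `0`
and the value is `1`. -/
noncomputable def cC {n : ℕ} (G : Digraph (Fin n)) (a : ℝ) (φ φNext : Fin n → ℝ) : ℝ :=
  √(1 - vmin φNext * a ^ 2 / (vmax φ ^ 2 * (diameter G : ℝ) * (maxEdgeUtility G : ℝ)))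

/-- `τ_k`, as a function of `𝔾_k`, `b`, `π_k` and `π_{k+1}`. For `n = 1` the denominator is `0`
and the value is `1`. -/
noncomputable def tauC {n : ℕ} (G : Digraph (Fin n)) (b : ℝ) (π πNext : Fin n → ℝ) : ℝ :=
  √(1 - vmin π ^ 2 * b ^ 2 /
    (vmax π ^ 2 * vmax πNext * (diameter G : ℝ) * (maxEdgeUtility G : ℝ)))

/-- `q_k(α)`, as a function of `π_k`. -/
noncomputable def qC {n : ℕ} (μ L α : ℝ) (π : Fin n → ℝ) : ℝ :=
  max |1 - α * n * vmin π * μ| |1 - α * n * vmin π * L|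

/-- The matrix `M` in terms of the scalar parameters; `ϕ` and `ϕ'` stand for the constants
`√(1 / min φ)` at times `k` and `k + 1`. -/
noncomputable def matM (n : ℕ) (L α β γ q c τ r ϕ ϕ' : ℝ) : Matrix (Fin 4) (Fin 4) ℝ :=
  let m41 := α * L * √(n : ℝ) * ϕ
  let m42 := c * ϕ' + ϕ + α * L * √(n : ℝ) * ϕ
  let m43 := α
  let m44 := β + γ * √(n : ℝ) * (1 + α * L)
  !![q, α * L * √(n : ℝ) * ϕ, α, β + γ * (1 + α * L * √(n : ℝ));
     α * L * √(n : ℝ) * ϕ, c + α * L * √(n : ℝ) * ϕ, α, β + γ * (c + α * L * √(n : ℝ));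
     L * r * (1 + γ) * m41, L * r * (1 + γ) * m42, τ + L * r * (1 + γ) * m43,
       L * r * γ + L * r * (1 + γ) * m44;
     m41, m42, m43, m44]

/-- The matrix `M_k(α, β, γ)`. -/
noncomputable def stepMatrix {n : ℕ} (G : ℕ → Digraph (Fin n)) (φ π : ℕ → Fin n → ℝ)
    (a b L μ α β γ : ℝ) (k : ℕ) : Matrix (Fin 4) (Fin 4) ℝ :=
  matM n L α β γ (qC μ L α (π k)) (cC (G k) a (φ k) (φ (k + 1)))
    (tauC (G k) b (π k) (π (k + 1))) (rC (π (k + 1))) (varphiC (φ k)) (varphiC (φ (k + 1)))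

end ABPushPull

namespace ABPushPull

/-! ### Weighted norms -/

section WeightedNorm

variable {n p : ℕ} {w : Fin n → ℝ} {z u : Fin n → EuclideanSpace ℝ (Fin p)}

/-! Each row of the inequality is a triangle inequality applied to an exact decomposition of the
update; two mechanisms supply the contraction.

Mixing. As `φ (k+1) ᵥ* A k = φ k`, averaging by `A k` preserves the weighted mean, and by the
parallel-axis identity `sum_mul_norm_sub_sq` the weighted variance drops by exactly the `φ
(k+1)`-average of the variances inside the rows of `A k`. This drop dominates squared differences
across edges, while routing every pair of nodes along a shortest path bounds the whole variance by
those same edge differences (`sum_norm_sub_sq_le`). Comparing the two gives `consErr_row_wavg_le`.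
The tracker reduces to this case: `B` conjugated by the weights `π` is row-stochastic and mixes `y /
π` (`trackErr_mul_le`).

Descent. Column stochasticity keeps `∑ y` equal to the sum of local gradients (`sum_iter_y`), so the
weighted average performs, up to error terms, a gradient step on `f` of length `α n θ`, where `θ` is
the dot product of `φ (k+1)` and `π k`. `norm_gradient_step_le` contracts it and
`max_abs_one_sub_le_qC` replaces `θ` by `vmin π`.

The remaining terms are Lipschitz bounds: the local gradients sum to zero at the minimizer, so `∑ y`
is controlled by the optimality, consensus and momentum errors (`norm_sum_tracker_le`). Row 3 is row
4 fed through the increment of `s`. -/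

theorem wnorm_nonneg : 0 ≤ wnorm w z := Real.sqrt_nonneg _

theorem wnorm_sq (hw : 0 ≤ w) : wnorm w z ^ 2 = ∑ i, w i * ‖z i‖ ^ 2 :=
  Real.sq_sqrt (Finset.sum_nonneg fun i _ => mul_nonneg (hw i) (sq_nonneg _))

/-- Scaling by `√(w i)` turns the weighted seminorm into a genuine `L²` norm, from which the
triangle inequality is inherited, zero weights included. -/
theorem wnorm_eq_norm_toLp (hw : 0 ≤ w) :
    wnorm w z = ‖(WithLp.toLp 2 (fun i => √(w i) • z i) :
      PiLp 2 (fun _ : Fin n => EuclideanSpace ℝ (Fin p)))‖ := by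
  rw [PiLp.norm_eq_of_L2, wnorm]
  congr 1
  refine Finset.sum_congr rfl fun i _ => ?_
  rw [norm_smul, mul_pow, Real.norm_eq_abs, sq_abs, Real.sq_sqrt (hw i)]

theorem wnorm_add_le (hw : 0 ≤ w) :
    wnorm w (fun i => z i + u i) ≤ wnorm w z + wnorm w u := by
  rw [wnorm_eq_norm_toLp hw, wnorm_eq_norm_toLp hw, wnorm_eq_norm_toLp hw]
  refine le_trans (le_of_eq ?_) (norm_add_le _ _)
  congr 1
  ext i
  simp [smul_add]

theorem wnorm_smul (c : ℝ) : wnorm w (fun i => c • z i) = |c| * wnorm w z := by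
  rw [wnorm, wnorm, ← Real.sqrt_sq_eq_abs, ← Real.sqrt_mul (sq_nonneg c), Finset.mul_sum]
  congr 1
  refine Finset.sum_congr rfl fun i _ => ?_
  rw [norm_smul, mul_pow, Real.norm_eq_abs, sq_abs]
  ring

theorem wnorm_neg : wnorm w (fun i => -z i) = wnorm w z := by
  simp [wnorm]

theorem wnorm_sub_le (hw : 0 ≤ w) :
    wnorm w (fun i => z i - u i) ≤ wnorm w z + wnorm w u := by
  have h := wnorm_add_le (z := z) (u := fun i => -u i) hw
  rw [wnorm_neg] at h
  simpa only [sub_eq_add_neg] using h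

theorem wnorm_le_of_norm_le {v : Fin n → ℝ} {q : ℕ} {t : Fin n → EuclideanSpace ℝ (Fin q)}
    {c : ℝ} (hc : 0 ≤ c) (h : ∀ i, w i * ‖z i‖ ^ 2 ≤ c ^ 2 * (v i * ‖t i‖ ^ 2)) :
    wnorm w z ≤ c * wnorm v t := by
  rw [wnorm, wnorm, ← Real.sqrt_sq hc, ← Real.sqrt_mul (sq_nonneg c), Finset.mul_sum]
  exact Real.sqrt_le_sqrt (Finset.sum_le_sum fun i _ => h i)

theorem norm_le_wnorm_one (i : Fin n) : ‖z i‖ ≤ wnorm 1 z := by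
  refine Real.le_sqrt_of_sq_le ?_
  refine le_trans (le_of_eq ?_) (Finset.single_le_sum
    (f := fun i => (1 : Fin n → ℝ) i * ‖z i‖ ^ 2) (fun j _ => by simp) (Finset.mem_univ i))
  simp

theorem sum_norm_le_sqrt_mul_wnorm_one : ∑ i, ‖z i‖ ≤ √(n : ℝ) * wnorm 1 z := by
  rw [wnorm, ← Real.sqrt_mul (Nat.cast_nonneg n)]
  refine Real.le_sqrt_of_sq_le ?_
  simpa using sq_sum_le_card_mul_sum_sq (s := Finset.univ) (f := fun i => ‖z i‖)

theorem wnorm_one_le_of_norm_le {c : ℝ} (hc : 0 ≤ c) (h : ∀ i, ‖z i‖ ≤ c) :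
    wnorm 1 z ≤ √(n : ℝ) * c := by
  rw [wnorm, ← Real.sqrt_sq hc, ← Real.sqrt_mul (Nat.cast_nonneg n)]
  refine Real.sqrt_le_sqrt ?_
  calc ∑ i, (1 : Fin n → ℝ) i * ‖z i‖ ^ 2 ≤ ∑ _i : Fin n, c ^ 2 := by
        refine Finset.sum_le_sum fun i _ => ?_
        simpa using pow_le_pow_left₀ (norm_nonneg _) (h i) 2
    _ = n * c ^ 2 := by simp

/-! ### Weighted averages and variances -/

theorem le_one_of_mem_stdSimplex (hw : w ∈ stdSimplex ℝ (Fin n)) (i : Fin n) : w i ≤ 1 := by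
  rw [← hw.2]
  exact Finset.single_le_sum (f := w) (fun j _ => hw.1 j) (Finset.mem_univ i)

theorem norm_wavg_le_of_norm_le (hw : w ∈ stdSimplex ℝ (Fin n)) {c : ℝ} (h : ∀ i, ‖z i‖ ≤ c) :
    ‖wavg w z‖ ≤ c := by
  calc ‖wavg w z‖ ≤ ∑ i, ‖w i • z i‖ := norm_sum_le _ _
    _ ≤ ∑ i, w i * c := by
        refine Finset.sum_le_sum fun i _ => ?_
        rw [norm_smul, Real.norm_of_nonneg (hw.1 i)]
        exact mul_le_mul_of_nonneg_left (h i) (hw.1 i)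
    _ = c := by rw [← Finset.sum_mul, hw.2, one_mul]

theorem wnorm_le_of_forall_norm_le (hw : w ∈ stdSimplex ℝ (Fin n)) {c : ℝ} (hc : 0 ≤ c)
    (h : ∀ i, ‖z i‖ ≤ c) : wnorm w z ≤ c := by
  refine Real.sqrt_le_iff.2 ⟨hc, ?_⟩
  calc ∑ i, w i * ‖z i‖ ^ 2 ≤ ∑ i, w i * c ^ 2 := Finset.sum_le_sum fun i _ =>
        mul_le_mul_of_nonneg_left (pow_le_pow_left₀ (norm_nonneg _) (h i) 2) (hw.1 i)
    _ = c ^ 2 := by rw [← Finset.sum_mul, hw.2, one_mul]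

theorem wavg_add : wavg w (fun i => z i + u i) = wavg w z + wavg w u := by
  simp [wavg, Finset.sum_add_distrib]

theorem wavg_sub : wavg w (fun i => z i - u i) = wavg w z - wavg w u := by
  simp [wavg, smul_sub]

theorem wavg_smul (c : ℝ) : wavg w (fun i => c • z i) = c • wavg w z := by
  simp [wavg, Finset.smul_sum, smul_comm c]

theorem wavg_const (hw : ∑ i, w i = 1) (c : EuclideanSpace ℝ (Fin p)) :
    wavg w (fun _ => c) = c := by
  rw [wavg, ← Finset.sum_smul, hw, one_smul]

/-- Parallel-axis identity with the variance in pairwise form. It is used with the weights `w` and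
also with each row of a stochastic matrix; nonnegativity of `w` plays no role. -/
theorem sum_mul_norm_sub_sq (hw : ∑ i, w i = 1) (c : EuclideanSpace ℝ (Fin p)) :
    ∑ i, w i * ‖z i - c‖ ^ 2 =
      ‖wavg w z - c‖ ^ 2 + 1 / 2 * ∑ i, ∑ j, w i * w j * ‖z i - z j‖ ^ 2 := by
  set v : Fin n → EuclideanSpace ℝ (Fin p) := fun i => z i - c with hv
  have hav : wavg w z - c = wavg w v := by rw [hv, wavg_sub, wavg_const hw]
  have h1 : ‖wavg w v‖ ^ 2 = ∑ i, ∑ j, w i * w j * inner ℝ (v i) (v j) := by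
    rw [← real_inner_self_eq_norm_sq, wavg, sum_inner]
    refine Finset.sum_congr rfl fun i _ => ?_
    rw [inner_sum]
    refine Finset.sum_congr rfl fun j _ => ?_
    rw [real_inner_smul_left, real_inner_smul_right]
    ring
  have h2 : ∀ i j, w i * w j * ‖z i - z j‖ ^ 2 =
      w j * (w i * ‖v i‖ ^ 2) - 2 * (w i * w j * inner ℝ (v i) (v j)) +
        w i * (w j * ‖v j‖ ^ 2) := by
    intro i j
    have : z i - z j = v i - v j := by simp [hv]
    rw [this, norm_sub_sq_real]
    ring
  have h3 : ∑ i, ∑ j, w i * w j * ‖z i - z j‖ ^ 2 =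
      2 * ∑ i, w i * ‖v i‖ ^ 2 - 2 * ‖wavg w v‖ ^ 2 := by
    simp only [h2, Finset.sum_add_distrib, Finset.sum_sub_distrib, ← Finset.sum_mul,
      ← Finset.mul_sum, hw, one_mul, h1]
    ring
  rw [h3, hav]
  ring

theorem consErr_sq (hw : w ∈ stdSimplex ℝ (Fin n)) :
    consErr z w ^ 2 = 1 / 2 * ∑ i, ∑ j, w i * w j * ‖z i - z j‖ ^ 2 := by
  rw [consErr, wnorm_sq hw.1, sum_mul_norm_sub_sq hw.2, sub_self]
  simp

theorem wnorm_sub_const_sq (hw : w ∈ stdSimplex ℝ (Fin n)) (c : EuclideanSpace ℝ (Fin p)) :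
    wnorm w (fun i => z i - c) ^ 2 = ‖wavg w z - c‖ ^ 2 + consErr z w ^ 2 := by
  rw [wnorm_sq hw.1, sum_mul_norm_sub_sq hw.2, consErr_sq hw]

theorem consErr_nonneg : 0 ≤ consErr z w := wnorm_nonneg

theorem wnorm_sub_const_le (hw : w ∈ stdSimplex ℝ (Fin n)) (c : EuclideanSpace ℝ (Fin p)) :
    wnorm w (fun i => z i - c) ≤ ‖wavg w z - c‖ + consErr z w := by
  refine abs_le_of_sq_le_sq' ?_ (add_nonneg (norm_nonneg _) consErr_nonneg) |>.2
  rw [wnorm_sub_const_sq hw]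
  nlinarith [norm_nonneg (wavg w z - c), consErr_nonneg (z := z) (w := w)]

theorem consErr_le_wnorm (hw : w ∈ stdSimplex ℝ (Fin n)) : consErr z w ≤ wnorm w z := by
  refine abs_le_of_sq_le_sq' ?_ wnorm_nonneg |>.2
  have h := wnorm_sub_const_sq (z := z) hw 0
  simp only [sub_zero] at h
  rw [h]
  nlinarith [sq_nonneg ‖wavg w z‖]

theorem consErr_add_le (hw : 0 ≤ w) :
    consErr (fun i => z i + u i) w ≤ consErr z w + consErr u w := by
  refine le_trans (le_of_eq ?_) (wnorm_add_le hw)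
  rw [consErr, wavg_add]
  congr 1
  ext1 i
  abel

theorem consErr_sub_le (hw : 0 ≤ w) :
    consErr (fun i => z i - u i) w ≤ consErr z w + consErr u w := by
  refine le_trans (le_of_eq ?_) (wnorm_sub_le hw)
  rw [consErr, wavg_sub]
  congr 1
  ext1 i
  abel

theorem consErr_smul (c : ℝ) : consErr (fun i => c • z i) w = |c| * consErr z w := by
  rw [consErr, wavg_smul, consErr, ← wnorm_smul]
  simp only [smul_sub]

/-! ### Smallest and largest entries -/

variable {v : Fin n → ℝ}

theorem vmin_le (v : Fin n → ℝ) (i : Fin n) : vmin v ≤ v i :=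
  ciInf_le (Set.finite_range v).bddBelow i

theorem le_vmax (v : Fin n → ℝ) (i : Fin n) : v i ≤ vmax v :=
  le_ciSup (Set.finite_range v).bddAbove i

theorem exists_vmin_eq [NeZero n] (v : Fin n → ℝ) : ∃ i, v i = vmin v :=
  exists_eq_ciInf_of_finite

theorem exists_vmax_eq [NeZero n] (v : Fin n → ℝ) : ∃ i, v i = vmax v :=
  exists_eq_ciSup_of_finite

theorem vmin_pos [NeZero n] (h : ∀ i, 0 < v i) : 0 < vmin v := by
  obtain ⟨i, hi⟩ := exists_vmin_eq v
  exact hi ▸ h i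

theorem wnorm_one_le_varphiC_mul [NeZero n] (h : ∀ i, 0 < w i) :
    wnorm 1 z ≤ varphiC w * wnorm w z := by
  refine wnorm_le_of_norm_le (Real.sqrt_nonneg _) fun i => ?_
  have hm := vmin_pos h
  rw [varphiC, Real.sq_sqrt (by positivity), Pi.one_apply, one_mul, ← mul_assoc]
  refine le_mul_of_one_le_left (sq_nonneg _) ?_
  rw [one_div, inv_mul_eq_div, one_le_div hm]
  exact vmin_le w i

end WeightedNorm

/-! ### Shortest paths and coverings -/

section Graph

variable {n : ℕ} {G : Digraph (Fin n)}

/-- On `ℕ`, `sSup` of an unbounded set is `0`, so the suprema defining the graph constants are upper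
bounds only once some finite bound is known. This crude one serves the diameter; `edgeUtility_le`
and `coveringUtility_le` serve the utility. -/
theorem IsDirPath.pathLength_le {j l : Fin n} {p : List (Fin n)} (h : IsDirPath G j l p) :
    pathLength p ≤ n :=
  (Nat.sub_le _ _).trans (by simpa using h.2.2.2.length_le_card)

theorem exists_isShortestPath (hG : StronglyConnected G) {j l : Fin n} (hjl : j ≠ l) :
    ∃ p, IsShortestPath G j l p := by
  obtain ⟨p, hp⟩ := exists_minimal_of_wellFoundedLT
    (fun m => ∃ p, IsDirPath G j l p ∧ pathLength p = m)
    (let ⟨p, hp⟩ := hG j l hjl; ⟨_, p, hp, rfl⟩)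
  obtain ⟨⟨q, hq, rfl⟩, hmin⟩ := hp
  refine ⟨q, hq, fun r hr => ?_⟩
  by_contra! hlt
  exact absurd (hmin ⟨r, hr, rfl⟩ hlt.le) (not_le.2 hlt)

theorem exists_isCovering (hG : StronglyConnected G) : ∃ P, IsCovering G P := by
  classical
  choose f hf using fun (j l : Fin n) (h : j ≠ l) => exists_isShortestPath hG h
  exact ⟨fun j l => if h : j ≠ l then f j l h else [], fun j l h => by
    simpa only [dif_pos h] using hf j l h⟩

theorem IsShortestPath.pathLength_le_diameter {j l : Fin n} {p : List (Fin n)} (hjl : j ≠ l)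
    (h : IsShortestPath G j l p) : pathLength p ≤ diameter G := by
  refine le_csSup ⟨n, ?_⟩ ⟨j, l, p, hjl, h, rfl⟩
  rintro m ⟨j, l, p, -, hp, rfl⟩
  exact hp.1.pathLength_le

theorem edgeUtility_le (P : Fin n → Fin n → List (Fin n)) (u v : Fin n) :
    edgeUtility P u v ≤ n * n := by
  refine (Set.ncard_le_card _).trans ?_
  simp

theorem coveringUtility_le (P : Fin n → Fin n → List (Fin n)) :
    coveringUtility G P ≤ n * n := by
  refine csSup_le' ?_
  rintro m ⟨u, v, -, rfl⟩
  exact edgeUtility_le P u v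

theorem IsCovering.edgeUtility_le_maxEdgeUtility {P : Fin n → Fin n → List (Fin n)}
    (hP : IsCovering G P) {u v : Fin n} (huv : G.Adj u v) :
    edgeUtility P u v ≤ maxEdgeUtility G := by
  have h : edgeUtility P u v ≤ coveringUtility G P := by
    refine le_csSup ⟨n * n, ?_⟩ ⟨u, v, huv, rfl⟩
    rintro m ⟨u, v, -, rfl⟩
    exact edgeUtility_le P u v
  refine h.trans (le_csSup ⟨n * n, ?_⟩ ⟨P, hP, rfl⟩)
  rintro m ⟨P, -, rfl⟩
  exact coveringUtility_le P

open Classical in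
/-- The set of edges traversed by a list of nodes. -/
noncomputable def pathEdges (p : List (Fin n)) : Finset (Fin n × Fin n) :=
  Finset.univ.filter fun e => [e.1, e.2] <:+: p

theorem mem_pathEdges {p : List (Fin n)} {e : Fin n × Fin n} :
    e ∈ pathEdges p ↔ [e.1, e.2] <:+: p := by
  simp [pathEdges]

theorem pathEdges_cons_cons (c d : Fin n) (t : List (Fin n)) :
    pathEdges (c :: d :: t) = insert (c, d) (pathEdges (d :: t)) := by
  ext ⟨u, v⟩
  rw [Finset.mem_insert, mem_pathEdges, mem_pathEdges, List.infix_cons_iff]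
  simp [List.cons_prefix_cons]

theorem card_pathEdges_le (p : List (Fin n)) : (pathEdges p).card ≤ pathLength p := by
  induction p with
  | nil => simp [pathEdges, pathLength]
  | cons c t ih =>
    cases t with
    | nil =>
      have : pathEdges [c] = ∅ := by
        ext e
        rw [mem_pathEdges]
        simp [List.infix_cons_iff, List.cons_prefix_cons]
      simp [this]
    | cons d t =>
      rw [pathEdges_cons_cons]
      refine (Finset.card_insert_le _ _).trans ?_
      simp only [pathLength, List.length_cons] at ih ⊢
      omega

/-- Telescoping along the path. Since nodes do not repeat, neither do edges, so summing over the set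
`pathEdges p` loses nothing. -/
theorem norm_sub_le_sum_pathEdges {E : Type*} [SeminormedAddCommGroup E] (z : Fin n → E)
    (p : List (Fin n)) (hp : p.Nodup) {j l : Fin n} (hj : p.head? = some j)
    (hl : p.getLast? = some l) : ‖z j - z l‖ ≤ ∑ e ∈ pathEdges p, ‖z e.1 - z e.2‖ := by
  induction p generalizing j with
  | nil => simp at hj
  | cons c t ih =>
    obtain rfl : c = j := by simpa using hj
    cases t with
    | nil =>
      obtain rfl : c = l := by simpa using hl
      simpa using Finset.sum_nonneg fun e _ => norm_nonneg _
    | cons d t =>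
      have hc : (c, d) ∉ pathEdges (d :: t) := by
        rw [mem_pathEdges]
        intro h
        exact (List.nodup_cons.1 hp).1 (h.subset (by simp))
      rw [pathEdges_cons_cons, Finset.sum_insert hc]
      have h := ih (List.nodup_cons.1 hp).2 rfl (by simpa using hl)
      exact (norm_sub_le_norm_sub_add_norm_sub _ (z d) _).trans (by gcongr)

theorem norm_sub_sq_le_sum_pathEdges {E : Type*} [SeminormedAddCommGroup E] (z : Fin n → E)
    {j l : Fin n} {p : List (Fin n)} (hp : IsDirPath G j l p) :
    ‖z j - z l‖ ^ 2 ≤ pathLength p * ∑ e ∈ pathEdges p, ‖z e.1 - z e.2‖ ^ 2 := by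
  refine (pow_le_pow_left₀ (norm_nonneg _)
    (norm_sub_le_sum_pathEdges z p hp.2.2.2 hp.1 hp.2.1) 2).trans ?_
  refine sq_sum_le_card_mul_sum_sq.trans ?_
  refine mul_le_mul_of_nonneg_right ?_ (Finset.sum_nonneg fun _ _ => sq_nonneg _)
  exact_mod_cast card_pathEdges_le p

theorem IsDirPath.adj_of_mem_pathEdges {j l : Fin n} {p : List (Fin n)} (hp : IsDirPath G j l p)
    {e : Fin n × Fin n} (he : e ∈ pathEdges p) : G.Adj e.1 e.2 := by
  have := hp.2.2.1.infix (mem_pathEdges.1 he)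
  simpa using this

-- Double counting: Cauchy–Schwarz on a shortest path costs its length, at most the diameter; after
-- exchanging sums, each edge is charged once per covering path through it, at most `maxEdgeUtility
-- G` times.
open Classical in
theorem sum_norm_sub_sq_le {E : Type*} [SeminormedAddCommGroup E] (hG : StronglyConnected G)
    (z : Fin n → E) :
    ∑ j, ∑ l, ‖z j - z l‖ ^ 2 ≤ diameter G * maxEdgeUtility G *
      ∑ e : Fin n × Fin n, if G.Adj e.1 e.2 then ‖z e.1 - z e.2‖ ^ 2 else 0 := by
  obtain ⟨P, hP⟩ := exists_isCovering hG
  let O : Finset (Fin n × Fin n) := Finset.univ.filter fun d => d.1 ≠ d.2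
  have hO : ∀ d ∈ O, d.1 ≠ d.2 := fun d hd => (Finset.mem_filter.1 hd).2
  calc ∑ j, ∑ l, ‖z j - z l‖ ^ 2 = ∑ d : Fin n × Fin n, ‖z d.1 - z d.2‖ ^ 2 :=
        (Fintype.sum_prod_type (fun d : Fin n × Fin n => ‖z d.1 - z d.2‖ ^ 2)).symm
    _ = ∑ d ∈ O, ‖z d.1 - z d.2‖ ^ 2 := by
        refine (Finset.sum_subset (Finset.subset_univ _) fun d _ hd => ?_).symm
        have : d.1 = d.2 := by simpa [O] using hd
        simp [this]
    _ ≤ ∑ d ∈ O, diameter G * ∑ e ∈ pathEdges (P d.1 d.2), ‖z e.1 - z e.2‖ ^ 2 := by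
        refine Finset.sum_le_sum fun d hd => ?_
        have h := hP d.1 d.2 (hO d hd)
        refine (norm_sub_sq_le_sum_pathEdges z h.1).trans ?_
        refine mul_le_mul_of_nonneg_right ?_ (Finset.sum_nonneg fun _ _ => sq_nonneg _)
        exact_mod_cast h.pathLength_le_diameter (hO d hd)
    _ = diameter G * ∑ e : Fin n × Fin n, ∑ d ∈ O with e ∈ pathEdges (P d.1 d.2),
          ‖z e.1 - z e.2‖ ^ 2 := by
        rw [← Finset.mul_sum]
        congr 1
        refine Finset.sum_comm' fun d e => ?_
        simp
    _ ≤ diameter G * ∑ e : Fin n × Fin n, maxEdgeUtility G *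
          (if G.Adj e.1 e.2 then ‖z e.1 - z e.2‖ ^ 2 else 0) := by
        refine mul_le_mul_of_nonneg_left (Finset.sum_le_sum fun e _ => ?_) (Nat.cast_nonneg _)
        rw [Finset.sum_const, nsmul_eq_mul]
        split_ifs with he
        · refine mul_le_mul_of_nonneg_right ?_ (sq_nonneg _)
          refine Nat.cast_le.2 (le_trans (le_of_eq ?_) (hP.edgeUtility_le_maxEdgeUtility he))
          rw [edgeUtility, ← Set.ncard_coe_finset]
          congr 1
          ext d
          simp [O, mem_pathEdges]
        -- A pair that is not an edge lies on no path of the covering, so it is charged zero times.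
        · rw [Finset.filter_false_of_mem, Finset.card_empty]
          · simp
          · exact fun d hd hed => he ((hP d.1 d.2 (hO d hd)).1.adj_of_mem_pathEdges hed)
    _ = _ := by rw [← Finset.mul_sum, mul_assoc]

/-- A path from inside `Z` to a node outside must cross the boundary at some edge. -/
theorem StronglyConnected.exists_adj (hG : StronglyConnected G) {Z : Finset (Fin n)}
    (hne : Z.Nonempty) (hZ : Z ≠ Finset.univ) : ∃ i ∈ Z, ∃ j ∉ Z, G.Adj i j := by
  obtain ⟨j, hj⟩ := hne
  obtain ⟨l, hl⟩ : ∃ l, l ∉ Z := by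
    by_contra! h
    exact hZ (Finset.eq_univ_iff_forall.2 h)
  obtain ⟨p, hp⟩ := hG j l (by rintro rfl; exact hl hj)
  obtain ⟨hjp, hlp, hch, -⟩ := hp
  induction p generalizing j with
  | nil => simp at hjp
  | cons c t ih =>
    obtain rfl : c = j := by simpa using hjp
    cases t with
    | nil =>
      obtain rfl : c = l := by simpa using hlp
      exact absurd hj hl
    | cons d t =>
      rw [List.isChain_cons_cons] at hch
      by_cases hd : d ∈ Z
      · exact ih d hd rfl (by simpa using hlp) hch.2
      · exact ⟨c, hj, d, hd, hch.1⟩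

end Graph

/-! ### Contraction of the weighted variance -/

section Contraction

variable {n p : ℕ} {G : Digraph (Fin n)} {w w' : Fin n → ℝ} {C : Matrix (Fin n) (Fin n) ℝ}

theorem row_mem_stdSimplex (hC : C ∈ Matrix.rowStochastic ℝ (Fin n)) (i : Fin n) :
    C i ∈ stdSimplex ℝ (Fin n) := by
  rw [Matrix.mem_rowStochastic] at hC
  refine ⟨hC.1 i, ?_⟩
  simpa [Matrix.mulVec, dotProduct] using congrFun hC.2 i

theorem wavg_row_wavg (hww : w' ᵥ* C = w) (z : Fin n → EuclideanSpace ℝ (Fin p)) :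
    wavg w' (fun i => wavg (C i) z) = wavg w z := by
  simp only [wavg, ← hww, Matrix.vecMul, dotProduct, Finset.smul_sum, Finset.sum_smul, smul_smul]
  exact Finset.sum_comm

/-- One averaging step contracts the weighted variance. -/
theorem consErr_row_wavg_le (hG : StronglyConnected G) (hC : C ∈ Matrix.rowStochastic ℝ (Fin n))
    (hw : w ∈ stdSimplex ℝ (Fin n)) (hw' : w' ∈ stdSimplex ℝ (Fin n)) (hww : w' ᵥ* C = w)
    {δ : ℝ} (hδ0 : 0 ≤ δ) (hδ : ∀ i j, G.Adj j i → δ ≤ w' i * (C i i * C i j))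
    (z : Fin n → EuclideanSpace ℝ (Fin p)) :
    consErr (fun i => wavg (C i) z) w' ≤
      √(1 - δ / (vmax w ^ 2 * (diameter G : ℝ) * (maxEdgeUtility G : ℝ))) * consErr z w := by
  classical
  set K : ℝ := vmax w ^ 2 * (diameter G : ℝ) * (maxEdgeUtility G : ℝ) with hK
  have hK0 : 0 ≤ K := by positivity
  set E : ℝ := ∑ e : Fin n × Fin n, if G.Adj e.1 e.2 then ‖z e.1 - z e.2‖ ^ 2 else 0 with hE
  have hE0 : 0 ≤ E := Finset.sum_nonneg fun e _ => by split_ifs <;> positivity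
  have hCn : ∀ i j, 0 ≤ C i j := fun i => (row_mem_stdSimplex hC i).1
  -- The parallel-axis identity for each row `C i`, centred at the common mean `wavg w z`, then
  -- averaged with `w'`.
  have hid : consErr (fun i => wavg (C i) z) w' ^ 2 = consErr z w ^ 2 -
      ∑ i, w' i * (1 / 2 * ∑ j, ∑ l, C i j * C i l * ‖z j - z l‖ ^ 2) := by
    rw [consErr, consErr, wnorm_sq hw'.1, wnorm_sq hw.1, wavg_row_wavg hww]
    have h1 : ∀ i, ‖wavg (C i) z - wavg w z‖ ^ 2 = ∑ j, C i j * ‖z j - wavg w z‖ ^ 2 -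
        1 / 2 * ∑ j, ∑ l, C i j * C i l * ‖z j - z l‖ ^ 2 := fun i => by
      rw [sum_mul_norm_sub_sq (row_mem_stdSimplex hC i).2]
      ring
    simp only [h1, mul_sub, Finset.sum_sub_distrib]
    congr 1
    simp only [Finset.mul_sum]
    rw [Finset.sum_comm]
    refine Finset.sum_congr rfl fun j _ => ?_
    rw [← hww]
    simp only [Matrix.vecMul, dotProduct, Finset.sum_mul, mul_assoc]
  -- From the variance inside row `i` only the pairs `(j, i)` are kept; the self-weight `C i i`
  -- makes them count.
  have hred : 1 / 2 * (δ * E) ≤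
      ∑ i, w' i * (1 / 2 * ∑ j, ∑ l, C i j * C i l * ‖z j - z l‖ ^ 2) := by
    rw [hE, Fintype.sum_prod_type_right, Finset.mul_sum, Finset.mul_sum]
    refine Finset.sum_le_sum fun i _ => ?_
    rw [mul_left_comm (w' i)]
    refine mul_le_mul_of_nonneg_left ?_ (by norm_num : (0 : ℝ) ≤ 1 / 2)
    rw [Finset.mul_sum, Finset.mul_sum]
    refine Finset.sum_le_sum fun j _ => ?_
    calc δ * (if G.Adj j i then ‖z j - z i‖ ^ 2 else 0)
        ≤ w' i * (C i j * C i i * ‖z j - z i‖ ^ 2) := by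
          split_ifs with h
          · rw [mul_comm (C i j), ← mul_assoc]
            exact mul_le_mul_of_nonneg_right (hδ i j h) (sq_nonneg _)
          · rw [mul_zero]
            exact mul_nonneg (hw'.1 i) (mul_nonneg (mul_nonneg (hCn _ _) (hCn _ _)) (sq_nonneg _))
      _ ≤ _ := by
          refine mul_le_mul_of_nonneg_left ?_ (hw'.1 i)
          exact Finset.single_le_sum (f := fun l => C i j * C i l * ‖z j - z l‖ ^ 2)
            (fun l _ => mul_nonneg (mul_nonneg (hCn _ _) (hCn _ _)) (sq_nonneg _))
            (Finset.mem_univ i)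
  have hvar : consErr z w ^ 2 ≤ 1 / 2 * (K * E) := by
    rw [consErr_sq hw]
    refine mul_le_mul_of_nonneg_left ?_ (by norm_num)
    calc ∑ j, ∑ l, w j * w l * ‖z j - z l‖ ^ 2
        ≤ ∑ j, ∑ l, vmax w ^ 2 * ‖z j - z l‖ ^ 2 := by
          refine Finset.sum_le_sum fun j _ => Finset.sum_le_sum fun l _ => ?_
          refine mul_le_mul_of_nonneg_right ?_ (sq_nonneg _)
          rw [sq]
          exact mul_le_mul (le_vmax w j) (le_vmax w l) (hw.1 l) ((hw.1 j).trans (le_vmax w j))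
      _ = vmax w ^ 2 * ∑ j, ∑ l, ‖z j - z l‖ ^ 2 := by simp only [Finset.mul_sum]
      _ ≤ vmax w ^ 2 * (diameter G * maxEdgeUtility G * E) :=
          mul_le_mul_of_nonneg_left (sum_norm_sub_sq_le hG z) (sq_nonneg _)
      _ = K * E := by rw [hK]; ring
  have hdiv : δ / K * consErr z w ^ 2 ≤ 1 / 2 * (δ * E) := by
    -- `K = 0` covers `n = 1`: division by zero makes the claimed decrease `0`.
    rcases hK0.eq_or_lt with h0 | hpos
    · rw [← h0, div_zero, zero_mul]
      positivity
    · calc δ / K * consErr z w ^ 2 ≤ δ / K * (1 / 2 * (K * E)) :=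
            mul_le_mul_of_nonneg_left hvar (by positivity)
        _ = 1 / 2 * (δ * E) := by field_simp
  -- Only the variance factor has to be nonnegative here; the sign of `1 - δ / K` is never needed.
  rw [← Real.sqrt_sq (consErr_nonneg (z := z) (w := w)), ← Real.sqrt_mul' _ (sq_nonneg _)]
  refine Real.le_sqrt_of_sq_le ?_
  rw [hid]
  linarith

theorem consErr_mul_le (hG : StronglyConnected G) (hC : C ∈ Matrix.rowStochastic ℝ (Fin n))
    (hCG : AlignedA G C) (hw : w ∈ stdSimplex ℝ (Fin n)) (hw' : w' ∈ stdSimplex ℝ (Fin n))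
    (hww : w' ᵥ* C = w) {a : ℝ} (ha : 0 < a) (haC : ∀ i j, 0 < C i j → a ≤ C i j)
    (z : Fin n → EuclideanSpace ℝ (Fin p)) :
    consErr (fun i => wavg (C i) z) w' ≤ cC G a w w' * consErr z w := by
  have hmin : 0 ≤ vmin w' := Real.iInf_nonneg hw'.1
  refine consErr_row_wavg_le hG hC hw hw' hww (by positivity) (fun i j hji => ?_) z
  rw [sq]
  have hi := haC i i ((hCG i i).1 (Or.inr rfl))
  have hj := haC i j ((hCG i j).1 (Or.inl hji))
  exact mul_le_mul (vmin_le w' i) (mul_le_mul hi hj ha.le (ha.le.trans hi)) (by positivity)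
    (hw'.1 i)

/-- The `w`-average of `y i / w i` is `∑ y`, so the tracking error is a weighted variance too. -/
theorem trackErr_eq_consErr {y : Fin n → EuclideanSpace ℝ (Fin p)} (hw : ∀ i, 0 < w i) :
    trackErr y w = consErr (fun i => (w i)⁻¹ • y i) w := by
  have : wavg w (fun i => (w i)⁻¹ • y i) = ∑ l, y l := by
    refine Finset.sum_congr rfl fun i _ => ?_
    rw [smul_smul, mul_inv_cancel₀ (hw i).ne', one_smul]
  rw [trackErr, consErr, this]

/-- With `C i j = B i j * w j / w' i`, the rescaled vectors `y / w` are averaged by a row-stochastic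
matrix satisfying `w' ᵥ* C = w`. The entry bound is `δ = vmin w ^ 2 * b ^ 2 / vmax w'`, which puts
`vmax w'` in the denominator of `tauC`. -/
theorem trackErr_mul_le {B : Matrix (Fin n) (Fin n) ℝ} (hG : StronglyConnected G)
    (hB : B ∈ Matrix.colStochastic ℝ (Fin n)) (hBG : AlignedB G B)
    (hw : w ∈ stdSimplex ℝ (Fin n)) (hw' : w' ∈ stdSimplex ℝ (Fin n))
    (hpos : ∀ i, 0 < w i) (hpos' : ∀ i, 0 < w' i)
    (hww : B *ᵥ w = w') {b : ℝ} (hb : 0 < b) (hbB : ∀ i j, 0 < B i j → b ≤ B i j)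
    (y : Fin n → EuclideanSpace ℝ (Fin p)) :
    trackErr (fun i => wavg (B i) y) w' ≤ tauC G b w w' * trackErr y w := by
  rw [Matrix.mem_colStochastic] at hB
  have hcol : ∀ j, ∑ i, B i j = 1 := fun j => by
    simpa [Matrix.vecMul, dotProduct] using congrFun hB.2 j
  have hrow : ∀ i, ∑ j, B i j * w j = w' i := fun i => congrFun hww i
  let C : Matrix (Fin n) (Fin n) ℝ := Matrix.of fun i j => B i j * w j / w' i
  have hC : C ∈ Matrix.rowStochastic ℝ (Fin n) := by
    rw [Matrix.mem_rowStochastic]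
    refine ⟨fun i j => div_nonneg (mul_nonneg (hB.1 i j) (hpos j).le) (hpos' i).le, ?_⟩
    ext i
    simp [Matrix.mulVec, dotProduct, C, ← Finset.sum_div, hrow, (hpos' i).ne']
  have hCw : w' ᵥ* C = w := by
    ext j
    have : ∀ i, w' i * (B i j * w j / w' i) = B i j * w j := fun i => by
      field_simp [(hpos' i).ne']
    simp [Matrix.vecMul, dotProduct, C, this, ← Finset.sum_mul, hcol]
  have hmin : 0 ≤ vmin w := Real.iInf_nonneg hw.1
  have hmax : 0 ≤ vmax w' := Real.iSup_nonneg hw'.1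
  rw [trackErr_eq_consErr hpos, trackErr_eq_consErr hpos']
  have key := consErr_row_wavg_le hG hC hw hw' hCw (δ := vmin w ^ 2 * b ^ 2 / vmax w')
    (by positivity) (fun i j hji => ?_) (fun i => (w i)⁻¹ • y i)
  · have h1 : (fun i => wavg (C i) (fun j => (w j)⁻¹ • y j)) =
        fun i => (w' i)⁻¹ • wavg (B i) y := by
      ext1 i
      simp only [wavg, Finset.smul_sum, smul_smul, C, Matrix.of_apply]
      refine Finset.sum_congr rfl fun j _ => ?_
      congr 1
      field_simp [(hpos j).ne', (hpos' i).ne']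
    rw [h1, div_div] at key
    have h2 : vmax w' * (vmax w ^ 2 * (diameter G : ℝ) * (maxEdgeUtility G : ℝ)) =
        vmax w ^ 2 * vmax w' * (diameter G : ℝ) * (maxEdgeUtility G : ℝ) := by ring
    rwa [h2] at key
  · have hi := hbB i i ((hBG i i).1 (Or.inr rfl))
    have hj := hbB i j ((hBG j i).1 (Or.inl hji))
    have hw'i := hpos' i
    have h1 : w' i * (C i i * C i j) = (w i * w j) * (B i i * B i j) / w' i := by
      simp only [C, Matrix.of_apply]
      field_simp
    rw [h1]
    refine div_le_div₀ ?_ ?_ hw'i (le_vmax w' i)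
    · exact mul_nonneg (mul_nonneg (hw.1 i) (hw.1 j)) (mul_nonneg (hB.1 _ _) (hB.1 _ _))
    · rw [sq, sq]
      exact mul_le_mul (mul_le_mul (vmin_le w i) (vmin_le w j) hmin (hw.1 i))
        (mul_le_mul hi hj hb.le (hb.le.trans hi)) (by positivity)
        (mul_nonneg (hw.1 i) (hw.1 j))

end Contraction

/-! ### Positivity of the weight sequences -/

section Weights

variable {n : ℕ} {G : ℕ → Digraph (Fin n)} {A B : ℕ → Matrix (Fin n) (Fin n) ℝ} {a b : ℝ}

theorem piSeq_pos (hnet : IsNetwork G A B a b) (k : ℕ) (i : Fin n) : 0 < piSeq B k i := by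
  induction k generalizing i with
  | zero =>
    have : 0 < n := i.pos
    simp only [piSeq]
    positivity
  | succ k ih =>
    have hB := Matrix.mem_colStochastic.1 (hnet.col k)
    exact Finset.sum_pos' (fun j _ => mul_nonneg (hB.1 i j) (ih j).le)
      ⟨i, Finset.mem_univ i, mul_pos ((hnet.alignB k i i).1 (Or.inr rfl)) (ih i)⟩

theorem sum_colStochastic_smul {M : Type*} [AddCommGroup M] [Module ℝ M]
    {B : Matrix (Fin n) (Fin n) ℝ} (hB : B ∈ Matrix.colStochastic ℝ (Fin n)) (y : Fin n → M) :
    ∑ i, ∑ j, B i j • y j = ∑ j, y j := by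
  rw [Finset.sum_comm]
  refine Finset.sum_congr rfl fun j _ => ?_
  have : ∑ i, B i j = 1 := by
    simpa [Matrix.vecMul, dotProduct] using congrFun (Matrix.mem_colStochastic.1 hB).2 j
  rw [← Finset.sum_smul, this, one_smul]

theorem piSeq_mem_stdSimplex (hn : 1 ≤ n) (hnet : IsNetwork G A B a b) (k : ℕ) :
    piSeq B k ∈ stdSimplex ℝ (Fin n) := by
  refine ⟨fun i => (piSeq_pos hnet k i).le, ?_⟩
  induction k with
  | zero =>
    have : (n : ℝ) ≠ 0 := by positivity
    simp [piSeq, this]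
  | succ k ih => rw [← ih]; exact sum_colStochastic_smul (hnet.col k) (piSeq B k)

/-- A zero entry at time `k` forces zeros at time `k + 1` at the same node and at all its
out-neighbours. By strong connectivity a nonempty zero set therefore grows strictly, as it is never
everything; after `n + 1` steps it would have more than `n` elements. -/
theorem IsAbsProbSeq.pos (hnet : IsNetwork G A B a b) {φ : ℕ → Fin n → ℝ}
    (hφ : IsAbsProbSeq A φ) (k : ℕ) (i : Fin n) : 0 < φ k i := by
  classical
  let Z : ℕ → Finset (Fin n) := fun k => Finset.univ.filter fun i => φ k i = 0
  have hmem : ∀ k i, i ∈ Z k ↔ φ k i = 0 := fun k i => by simp [Z]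
  have hZ : ∀ k, Z k ≠ Finset.univ := fun k h => by
    have h0 : ∀ i, φ k i = 0 := fun i => (hmem k i).1 (h ▸ Finset.mem_univ i)
    have := (hφ.1 k).2
    simp [h0] at this
  have hstep : ∀ k i j, φ k j = 0 → 0 < A k i j → φ (k + 1) i = 0 := fun k i j hj hA => by
    rw [← hφ.2 k, Matrix.vecMul, dotProduct] at hj
    have hAn := (Matrix.mem_rowStochastic.1 (hnet.row k)).1
    have := (Finset.sum_eq_zero_iff_of_nonneg fun i _ =>
      mul_nonneg ((hφ.1 (k + 1)).1 i) (hAn i j)).1 hj i (Finset.mem_univ i)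
    exact (mul_eq_zero.1 this).resolve_right hA.ne'
  have hgrow : ∀ k, (Z k).Nonempty → Z k ⊂ Z (k + 1) := fun k hk => by
    refine Finset.ssubset_iff_subset_ne.2 ⟨fun i hi => ?_, fun h => ?_⟩
    · exact (hmem _ _).2 (hstep k i i ((hmem _ _).1 hi) ((hnet.alignA k i i).1 (Or.inr rfl)))
    · obtain ⟨i, hi, j, hj, hij⟩ := (hnet.strong k).exists_adj hk (hZ k)
      refine hj (h ▸ (hmem _ _).2 ?_)
      exact hstep k j i ((hmem _ _).1 hi) ((hnet.alignA k j i).1 (Or.inl hij))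
  refine lt_of_le_of_ne ((hφ.1 k).1 i) fun h => ?_
  have hne : ∀ m, (Z (k + m)).Nonempty ∧ m ≤ (Z (k + m)).card := fun m => by
    induction m with
    | zero => exact ⟨⟨i, (hmem _ _).2 h.symm⟩, Nat.zero_le _⟩
    | succ m ih =>
      have hlt := hgrow (k + m) ih.1
      exact ⟨ih.1.mono hlt.subset, Nat.succ_le_of_lt (ih.2.trans_lt (Finset.card_lt_card hlt))⟩
  have h1 := (hne (n + 1)).2.trans (Finset.card_le_univ _)
  simp at h1

end Weights

/-! ### Gradient steps on smooth strongly convex functions -/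

section Gradient

/-- Two distinct points are indispensable: in dimension `0` nothing relates `μ` to `L`. Uses of this
lemma therefore treat coinciding points separately. -/
theorem le_of_strongly_monotone {F : Type*} [NormedAddCommGroup F] [InnerProductSpace ℝ F]
    {L μ : ℝ} {x u : F} (hxu : x ≠ u) {g : F → F}
    (hL : ‖g x - g u‖ ≤ L * ‖x - u‖) (hμ : μ * ‖x - u‖ ^ 2 ≤ inner ℝ (g x - g u) (x - u)) :
    μ ≤ L := by
  have hpos : 0 < ‖x - u‖ := norm_pos_iff.2 (sub_ne_zero.2 hxu)
  have h := hμ.trans (real_inner_le_norm _ _)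
  refine le_of_mul_le_mul_right ?_ (pow_pos hpos 2)
  nlinarith

variable {F : Type*} [NormedAddCommGroup F] [InnerProductSpace ℝ F] [CompleteSpace F]
  {f : F → ℝ} {L μ : ℝ}

theorem hasDerivAt_comp_line (hf : Differentiable ℝ f) (x d : F) (t : ℝ) :
    HasDerivAt (fun t : ℝ => f (x + t • d)) (inner ℝ (gradient f (x + t • d)) d) t := by
  have h1 : HasDerivAt (fun t : ℝ => x + t • d) d t := by
    simpa using ((hasDerivAt_id t).smul_const d).const_add x
  rw [inner_gradient_left]
  exact (hf (x + t • d)).hasFDerivAt.comp_hasDerivAt t h1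

/-- A bound on the increments of the directional derivative gives a quadratic upper model. -/
theorem le_add_of_inner_gradient_sub_le (hf : Differentiable ℝ f)
    (h : ∀ x u, inner ℝ (gradient f x - gradient f u) (x - u) ≤ L * ‖x - u‖ ^ 2) (x d : F) :
    f (x + d) ≤ f x + inner ℝ (gradient f x) d + L / 2 * ‖d‖ ^ 2 := by
  have key := image_le_of_deriv_right_le_deriv_boundary (a := 0) (b := 1)
    (f := fun t : ℝ => f (x + t • d)) (f' := fun t => inner ℝ (gradient f (x + t • d)) d)
    (B := fun t => f x + t * inner ℝ (gradient f x) d + L / 2 * ‖d‖ ^ 2 * t ^ 2)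
    (B' := fun t => inner ℝ (gradient f x) d + L * ‖d‖ ^ 2 * t)
    (fun t _ => (hasDerivAt_comp_line hf x d t).continuousAt.continuousWithinAt)
    (fun t _ => (hasDerivAt_comp_line hf x d t).hasDerivWithinAt)
    (by simp) (by fun_prop)
    (fun t _ => by
      have h1 := (((hasDerivAt_id t).mul_const (inner ℝ (gradient f x) d)).const_add (f x)).add
        ((hasDerivAt_pow 2 t).const_mul (L / 2 * ‖d‖ ^ 2))
      refine (h1.congr_deriv ?_).hasDerivWithinAt
      simp
      ring)
    -- Slope comparison: equality at `t = 0`; for `t > 0` the hypothesis at `x + t • d` and `x` is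
    -- `t` times the wanted bound.
    (fun t ht => by
      rcases ht.1.eq_or_lt with rfl | ht0
      · simp
      · have := h (x + t • d) x
        rw [add_sub_cancel_left, real_inner_smul_right, norm_smul, inner_sub_left,
          Real.norm_of_nonneg ht0.le] at this
        have h2 : t * (inner ℝ (gradient f (x + t • d)) d - inner ℝ (gradient f x) d) ≤
            t * (L * ‖d‖ ^ 2 * t) := by linarith
        have := le_of_mul_le_mul_left h2 ht0
        linarith)
    (x := 1) (by simp)
  simpa using key

theorem gradient_fun_neg (x : F) : gradient (fun x => -f x) x = -gradient f x := by
  simp [gradient, fderiv_fun_neg]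

theorem add_le_of_le_inner_gradient_sub (hf : Differentiable ℝ f)
    (h : ∀ x u, μ * ‖x - u‖ ^ 2 ≤ inner ℝ (gradient f x - gradient f u) (x - u)) (x d : F) :
    f x + inner ℝ (gradient f x) d + μ / 2 * ‖d‖ ^ 2 ≤ f (x + d) := by
  have key := le_add_of_inner_gradient_sub_le (f := fun x => -f x) (L := -μ) hf.neg
    (fun x u => by
      rw [gradient_fun_neg, gradient_fun_neg, ← neg_sub_neg, neg_neg, neg_neg, ← neg_sub,
        inner_neg_left]
      linarith [h x u]) x d
  rw [gradient_fun_neg, inner_neg_left] at key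
  linarith

/-- The gradient stays within `(L - μ) / 2` of its midpoint linear part. This is cocoercivity of the
gradient of `f - μ/2 ‖·‖²`, obtained without second derivatives; `h` is that gradient's increment,
and expanding the square finishes. -/
theorem norm_gradient_sub_le (hf : Differentiable ℝ f) (hμL : μ ≤ L)
    (hL : ∀ x u, ‖gradient f x - gradient f u‖ ≤ L * ‖x - u‖)
    (hμ : ∀ x u, μ * ‖x - u‖ ^ 2 ≤ inner ℝ (gradient f x - gradient f u) (x - u)) (x u : F) :
    ‖gradient f x - gradient f u - ((μ + L) / 2) • (x - u)‖ ≤ (L - μ) / 2 * ‖x - u‖ := by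
  have hup : ∀ x u, inner ℝ (gradient f x - gradient f u) (x - u) ≤ L * ‖x - u‖ ^ 2 :=
    fun x u => (real_inner_le_norm _ _).trans (by nlinarith [hL x u, norm_nonneg (x - u)])
  set d := x - u with hd
  set h := gradient f x - gradient f u - μ • d with hh
  -- Upper models from `u` and `x` meet lower models from the other point at `u + w` and `x - w`; in
  -- the sum all values of `f` cancel. The best `w` is `h / (L - μ)`.
  have main : ∀ w : F, 0 ≤ inner ℝ h d - 2 * inner ℝ h w + (L - μ) * ‖w‖ ^ 2 := fun w => by
    have h1 := le_add_of_inner_gradient_sub_le hf hup u w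
    have h2 := le_add_of_inner_gradient_sub_le hf hup x (-w)
    have h3 := add_le_of_le_inner_gradient_sub hf hμ x (w - d)
    have h4 := add_le_of_le_inner_gradient_sub hf hμ u (d - w)
    have e1 : x + (w - d) = u + w := by rw [hd]; abel
    have e2 : u + (d - w) = x + -w := by rw [hd]; abel
    rw [e1] at h3
    rw [e2] at h4
    rw [norm_sub_rev, norm_sub_sq_real] at h4
    rw [norm_sub_sq_real] at h3
    rw [norm_neg, inner_neg_right] at h2
    rw [inner_sub_right] at h3 h4
    simp only [hh, inner_sub_left, real_inner_smul_left, real_inner_self_eq_norm_sq]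
    rw [real_inner_comm d w] at *
    linarith
  have hcoc : ‖h‖ ^ 2 ≤ (L - μ) * inner ℝ h d := by
    have ht : ∀ t : ℝ, 0 ≤ inner ℝ h d - 2 * t * ‖h‖ ^ 2 + (L - μ) * t ^ 2 * ‖h‖ ^ 2 := fun t => by
      have := main (t • h)
      rw [real_inner_smul_right, real_inner_self_eq_norm_sq, norm_smul, mul_pow,
        Real.norm_eq_abs, sq_abs] at this
      linarith
    rcases (sub_nonneg.2 hμL).eq_or_lt with h0 | hpos
    · rw [← h0, zero_mul]
      by_contra! hlt
      -- When `L = μ` the quadratic term vanishes, and this multiple of `h` makes the expression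
      -- `-1`, so `h` must be zero.
      have := ht ((inner ℝ h d + 1) / (2 * ‖h‖ ^ 2))
      rw [← h0] at this
      have e : 2 * ((inner ℝ h d + 1) / (2 * ‖h‖ ^ 2)) * ‖h‖ ^ 2 = inner ℝ h d + 1 := by
        rw [mul_right_comm, mul_comm, div_mul_cancel₀ _ (by positivity)]
      rw [e] at this
      linarith
    · have := ht (L - μ)⁻¹
      have e : (L - μ) * (L - μ)⁻¹ ^ 2 = (L - μ)⁻¹ := by field_simp
      rw [e] at this
      have h5 : (L - μ)⁻¹ * ‖h‖ ^ 2 ≤ inner ℝ h d := by linarith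
      rwa [inv_mul_le_iff₀ hpos] at h5
  refine abs_le_of_sq_le_sq' ?_ (by nlinarith [norm_nonneg d]) |>.2
  have e : gradient f x - gradient f u - ((μ + L) / 2) • d = h - ((L - μ) / 2) • d := by
    rw [hh, sub_sub _ (μ • d), ← add_smul]
    congr 2
    ring
  rw [e, norm_sub_sq_real, real_inner_smul_right, norm_smul, mul_pow, Real.norm_eq_abs, sq_abs,
    mul_pow]
  linarith

/-- Splitting off the midpoint slope gives the factor `|1 - η (μ + L) / 2| + η (L - μ) / 2`, which
equals `1 - η μ` or `η L - 1` according to the sign inside the absolute value. -/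
theorem norm_gradient_step_le (hf : Differentiable ℝ f)
    (hL : ∀ x u, ‖gradient f x - gradient f u‖ ≤ L * ‖x - u‖)
    (hμ : ∀ x u, μ * ‖x - u‖ ^ 2 ≤ inner ℝ (gradient f x - gradient f u) (x - u))
    {η : ℝ} (hη : 0 ≤ η) (x u : F) :
    ‖(x - u) - η • (gradient f x - gradient f u)‖ ≤
      max |1 - η * μ| |1 - η * L| * ‖x - u‖ := by
  rcases eq_or_ne x u with rfl | hxu
  · simp
  have hμL : μ ≤ L := le_of_strongly_monotone hxu (hL x u) (hμ x u)
  have key := norm_gradient_sub_le hf hμL hL hμ x u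
  set d := x - u
  set g := gradient f x - gradient f u
  have e : d - η • g = (1 - η * ((μ + L) / 2)) • d - η • (g - ((μ + L) / 2) • d) := by
    rw [smul_sub η g, smul_smul, sub_smul, one_smul]
    abel
  rw [e]
  refine (norm_sub_le _ _).trans ?_
  rw [norm_smul, norm_smul, Real.norm_of_nonneg hη, Real.norm_eq_abs]
  calc |1 - η * ((μ + L) / 2)| * ‖d‖ + η * ‖g - ((μ + L) / 2) • d‖
      ≤ |1 - η * ((μ + L) / 2)| * ‖d‖ + η * ((L - μ) / 2 * ‖d‖) := by gcongr
    _ = (|1 - η * ((μ + L) / 2)| + η * ((L - μ) / 2)) * ‖d‖ := by ring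
    _ ≤ _ := by
        refine mul_le_mul_of_nonneg_right ?_ (norm_nonneg d)
        rcases abs_cases (1 - η * ((μ + L) / 2)) with ⟨h, -⟩ | ⟨h, -⟩
        · refine le_max_of_le_left ((le_abs_self _).trans' ?_)
          rw [h]
          linarith
        · refine le_max_of_le_right ((neg_le_abs _).trans' ?_)
          rw [h]
          linarith

theorem gradient_eq_zero_of_isMinOn {x : F} (h : IsMinOn f Set.univ x) : gradient f x = 0 := by
  have := (h.isLocalMin Filter.univ_mem).fderiv_eq_zero
  simp [gradient, this]

end Gradient

/-! ### The average cost -/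

section Average

variable {n p : ℕ} {f : Fin n → EuclideanSpace ℝ (Fin p) → ℝ} {L μ : ℝ}

theorem SmoothCosts.differentiable (hf : SmoothCosts f L) (i : Fin n) : Differentiable ℝ (f i) :=
  (hf i).1.differentiable one_ne_zero

theorem SmoothCosts.differentiable_avgFun (hf : SmoothCosts f L) :
    Differentiable ℝ (avgFun f) := by
  have := hf.differentiable
  unfold avgFun
  fun_prop

theorem SmoothCosts.gradient_avgFun (hf : SmoothCosts f L) (x : EuclideanSpace ℝ (Fin p)) :
    gradient (avgFun f) x = (1 / (n : ℝ)) • ∑ i, gradient (f i) x := by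
  have hd : ∀ i, DifferentiableAt ℝ (f i) x := fun i => hf.differentiable i x
  have h : fderiv ℝ (avgFun f) x = (1 / (n : ℝ)) • ∑ i, fderiv ℝ (f i) x := by
    unfold avgFun
    rw [fderiv_const_mul (by fun_prop), fderiv_fun_sum fun i _ => hd i]
  simp only [gradient, h, map_smul, map_sum]

theorem SmoothCosts.sum_gradient (hn : 1 ≤ n) (hf : SmoothCosts f L)
    (x : EuclideanSpace ℝ (Fin p)) :
    ∑ i, gradient (f i) x = (n : ℝ) • gradient (avgFun f) x := by
  have : (n : ℝ) ≠ 0 := by positivity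
  rw [hf.gradient_avgFun, smul_smul, mul_one_div_cancel this, one_smul]

theorem SmoothCosts.norm_gradient_avgFun_sub_le (hn : 1 ≤ n) (hf : SmoothCosts f L)
    (x u : EuclideanSpace ℝ (Fin p)) :
    ‖gradient (avgFun f) x - gradient (avgFun f) u‖ ≤ L * ‖x - u‖ := by
  have hn0 : (0 : ℝ) < n := by positivity
  rw [hf.gradient_avgFun, hf.gradient_avgFun, ← smul_sub, ← Finset.sum_sub_distrib, norm_smul,
    Real.norm_of_nonneg (by positivity), one_div, inv_mul_le_iff₀ hn0]
  refine (norm_sum_le _ _).trans ?_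
  refine (Finset.sum_le_sum fun i _ => (hf i).2 x u).trans (le_of_eq ?_)
  simp

end Average

/-! ### One step of the error recursion -/

section Step

variable {n p : ℕ}

theorem norm_wavg_le_wnorm {w : Fin n → ℝ} {z : Fin n → EuclideanSpace ℝ (Fin p)}
    (hw : w ∈ stdSimplex ℝ (Fin n)) : ‖wavg w z‖ ≤ wnorm w z := by
  refine abs_le_of_sq_le_sq' ?_ wnorm_nonneg |>.2
  have h := wnorm_sub_const_sq (z := z) hw 0
  simp only [sub_zero] at h
  rw [h]
  nlinarith [sq_nonneg (consErr z w)]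

/-- Because `v i * w i ^ 2 ≤ w i`. This is why the tracking error enters rows 1, 2 and 4 with
coefficient exactly `α`. -/
theorem wnorm_smul_le_wnorm {v w : Fin n → ℝ} (hv : ∀ i, v i ≤ 1)
    (hw : w ∈ stdSimplex ℝ (Fin n)) (z : Fin n → EuclideanSpace ℝ (Fin p)) :
    wnorm v (fun i => w i • z i) ≤ wnorm w z := by
  have := wnorm_le_of_norm_le (w := v) (z := fun i => w i • z i) (v := w) (t := z) zero_le_one
    fun i => ?_
  · rwa [one_mul] at this
  · rw [norm_smul, mul_pow, Real.norm_eq_abs, sq_abs, one_pow, one_mul, ← mul_assoc]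
    refine mul_le_mul_of_nonneg_right ?_ (sq_nonneg _)
    have h0 := hw.1 i
    have h1 := le_one_of_mem_stdSimplex hw i
    nlinarith [hv i, mul_nonneg h0 h0, mul_nonneg h0 (sub_nonneg.2 h1)]

theorem wnorm_le_trackErr_add {v π : Fin n → ℝ} (hv0 : 0 ≤ v) (hv : ∀ i, v i ≤ 1)
    (hπ : π ∈ stdSimplex ℝ (Fin n)) (hpos : ∀ i, 0 < π i)
    (y : Fin n → EuclideanSpace ℝ (Fin p)) :
    wnorm v y ≤ trackErr y π + ‖∑ l, y l‖ := by
  have e : y = fun i => π i • ((π i)⁻¹ • y i - ∑ l, y l) + π i • ∑ l, y l := by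
    ext1 i
    rw [smul_sub, smul_smul, mul_inv_cancel₀ (hpos i).ne', one_smul, sub_add_cancel]
  calc wnorm v y
      = wnorm v (fun i => π i • ((π i)⁻¹ • y i - ∑ l, y l) + π i • ∑ l, y l) := by rw [← e]
    _ ≤ _ := wnorm_add_le hv0
    _ ≤ trackErr y π + wnorm π (fun _ => ∑ l, y l) :=
        add_le_add (wnorm_smul_le_wnorm hv hπ _) (wnorm_smul_le_wnorm hv hπ _)
    _ ≤ _ := by
        gcongr
        exact wnorm_le_of_forall_norm_le hπ (norm_nonneg _) fun _ => le_rfl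

theorem trackErr_add_le {π : Fin n → ℝ} (hpos : ∀ i, 0 < π i)
    (y g : Fin n → EuclideanSpace ℝ (Fin p)) :
    trackErr (fun i => y i + g i) π ≤ trackErr y π + trackErr g π := by
  rw [trackErr_eq_consErr hpos, trackErr_eq_consErr hpos, trackErr_eq_consErr hpos]
  simp only [smul_add]
  exact consErr_add_le fun i => (hpos i).le

/-- Centring only decreases the weighted norm, so `1 / √(vmin π)` already suffices; the summand `√n`
of `rC` is slack. -/
theorem trackErr_le_rC_mul [NeZero n] {π : Fin n → ℝ} (hπ : π ∈ stdSimplex ℝ (Fin n))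
    (hpos : ∀ i, 0 < π i) (g : Fin n → EuclideanSpace ℝ (Fin p)) :
    trackErr g π ≤ rC π * wnorm 1 g := by
  have hm := vmin_pos hpos
  rw [trackErr_eq_consErr hpos]
  refine (consErr_le_wnorm hπ).trans ?_
  refine (wnorm_le_of_norm_le (c := 1 / √(vmin π)) (v := 1) (t := g) (by positivity)
    fun i => ?_).trans ?_
  · have hi := hpos i
    rw [norm_smul, mul_pow, norm_inv, Real.norm_of_nonneg hi.le, div_pow, Real.sq_sqrt hm.le,
      Pi.one_apply, one_mul, one_pow, ← mul_assoc]
    refine mul_le_mul_of_nonneg_right ?_ (sq_nonneg _)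
    have : π i * (π i)⁻¹ ^ 2 = 1 / π i := by field_simp
    rw [this]
    exact one_div_le_one_div_of_le hm (vmin_le π i)
  · refine mul_le_mul_of_nonneg_right ?_ wnorm_nonneg
    rw [rC]
    linarith [Real.sqrt_nonneg (n : ℝ)]

variable {f : Fin n → EuclideanSpace ℝ (Fin p) → ℝ} {L : ℝ}

theorem SmoothCosts.wnorm_gradient_sub_le (hL : 0 ≤ L) (hf : SmoothCosts f L)
    (s u : Fin n → EuclideanSpace ℝ (Fin p)) :
    wnorm 1 (fun i => gradient (f i) (s i) - gradient (f i) (u i)) ≤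
      L * wnorm 1 (fun i => s i - u i) := by
  refine wnorm_le_of_norm_le hL fun i => ?_
  simpa [mul_pow] using pow_le_pow_left₀ (norm_nonneg _) ((hf i).2 (s i) (u i)) 2

theorem SmoothCosts.norm_sum_gradient_sub_le (hL : 0 ≤ L) (hf : SmoothCosts f L)
    (s u : Fin n → EuclideanSpace ℝ (Fin p)) :
    ‖∑ i, gradient (f i) (s i) - ∑ i, gradient (f i) (u i)‖ ≤
      L * √(n : ℝ) * wnorm 1 (fun i => s i - u i) := by
  rw [← Finset.sum_sub_distrib]
  refine (norm_sum_le _ _).trans (sum_norm_le_sqrt_mul_wnorm_one.trans ?_)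
  have := mul_le_mul_of_nonneg_left (hf.wnorm_gradient_sub_le hL s u) (Real.sqrt_nonneg (n : ℝ))
  linarith

/-- A convex combination of the entries of `π` lies between its extremes. If there are two nodes,
the largest entry plus another one is at most `1`; with a single node the combination is `vmin π`
itself. -/
theorem dotProduct_stdSimplex_bounds [NeZero n] {φ π : Fin n → ℝ}
    (hφ : φ ∈ stdSimplex ℝ (Fin n)) (hπ : π ∈ stdSimplex ℝ (Fin n)) :
    vmin π ≤ ∑ i, φ i * π i ∧ (∑ i, φ i * π i ≤ vmin π ∨ ∑ i, φ i * π i + vmin π ≤ 1) := by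
  constructor
  · calc vmin π = ∑ i, φ i * vmin π := by rw [← Finset.sum_mul, hφ.2, one_mul]
      _ ≤ _ := Finset.sum_le_sum fun i _ => mul_le_mul_of_nonneg_left (vmin_le π i) (hφ.1 i)
  · obtain ⟨i, hi⟩ := exists_vmax_eq π
    have hle : ∑ j, φ j * π j ≤ π i := by
      calc _ ≤ ∑ j, φ j * π i := Finset.sum_le_sum fun j _ =>
            mul_le_mul_of_nonneg_left (hi ▸ le_vmax π j) (hφ.1 j)
        _ = π i := by rw [← Finset.sum_mul, hφ.2, one_mul]
    by_cases h : ∃ l, l ≠ i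
    · obtain ⟨l, hl⟩ := h
      right
      have h2 : π i + π l ≤ 1 := by
        rw [← hπ.2, ← Finset.sum_pair hl.symm]
        exact Finset.sum_le_sum_of_subset_of_nonneg (Finset.subset_univ _) fun j _ _ => hπ.1 j
      linarith [vmin_le π l]
    · left
      push Not at h
      obtain ⟨j, hj⟩ := exists_vmin_eq π
      rw [← hj, h j]
      exact hle

/-- Put `η = α n`. If `θ + vmin π ≤ 1`, then `η L ≤ 2` gives `η θ L - 1 ≤ 1 - η (vmin π) L ≤ 1 - η
(vmin π) μ`, and `1 - η θ μ` obeys the same bound as `vmin π ≤ θ`. -/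
theorem max_abs_one_sub_le_qC {μ α θ : ℝ} {π : Fin n → ℝ} (hμ : 0 ≤ μ) (hμL : μ ≤ L)
    (hα : 0 ≤ α) (hαL : α * n * L ≤ 2) (hm : 0 ≤ vmin π) (hθ : vmin π ≤ θ)
    (hθ' : θ ≤ vmin π ∨ θ + vmin π ≤ 1) :
    max |1 - α * θ * n * μ| |1 - α * θ * n * L| ≤ qC μ L α π := by
  rcases hθ' with h | h
  · obtain rfl : θ = vmin π := le_antisymm h hθ
    rw [qC, mul_right_comm α (vmin π)]
  · have hη : 0 ≤ α * n := by positivity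
    set η := α * n with hηdef
    have e : ∀ t, α * θ * n * t = η * θ * t := fun t => by rw [hηdef]; ring
    rw [e, e]
    have h1 : η * vmin π * μ ≤ η * θ * μ := by gcongr
    have h2 : η * θ * μ ≤ η * θ * L := by
      have : 0 ≤ η * θ := mul_nonneg hη (hm.trans hθ)
      gcongr
    have h3 : η * vmin π * μ ≤ η * vmin π * L := by gcongr
    have h4 : η * θ * L + η * vmin π * L ≤ 2 := by
      nlinarith [mul_nonneg hη (hμ.trans hμL)]
    refine le_trans ?_ ((le_abs_self _).trans (le_max_left _ _))
    rw [← hηdef, max_le_iff, abs_le, abs_le]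
    refine ⟨⟨?_, ?_⟩, ?_, ?_⟩ <;> linarith

variable {G : Digraph (Fin n)} {A B : Matrix (Fin n) (Fin n) ℝ} {φ φ' π π' : Fin n → ℝ}
  {a b μ α β γ : ℝ} {σ : State n p} {xStar : EuclideanSpace ℝ (Fin p)}

theorem wnorm_sub_le_of_momentum (hγ : 0 ≤ γ)
    (hs : ∀ i, σ.s i = σ.x i + γ • (σ.x i - σ.xPrev i)) (c : EuclideanSpace ℝ (Fin p)) :
    wnorm 1 (fun i => σ.s i - c) ≤
      wnorm 1 (fun i => σ.x i - c) + γ * wnorm 1 (fun i => σ.x i - σ.xPrev i) := by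
  have e : (fun i => σ.s i - c) = fun i => (σ.x i - c) + γ • (σ.x i - σ.xPrev i) := by
    ext1 i
    rw [hs i]
    abel
  rw [e]
  refine (wnorm_add_le zero_le_one).trans ?_
  rw [wnorm_smul, abs_of_nonneg hγ]

theorem norm_sum_tracker_le [NeZero n] (hL : 0 ≤ L) (hf : SmoothCosts f L)
    (hmin : IsMinOn (avgFun f) Set.univ xStar) (hφ : φ ∈ stdSimplex ℝ (Fin n))
    (hφpos : ∀ i, 0 < φ i) (hγ : 0 ≤ γ)
    (hs : ∀ i, σ.s i = σ.x i + γ • (σ.x i - σ.xPrev i))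
    (hy : ∑ i, σ.y i = ∑ i, gradient (f i) (σ.s i)) :
    ‖∑ i, σ.y i‖ ≤ L * √(n : ℝ) * (varphiC φ * (‖wavg φ σ.x - xStar‖ + consErr σ.x φ) +
      γ * wnorm 1 (fun i => σ.x i - σ.xPrev i)) := by
  have h0 : ∑ i, gradient (f i) xStar = 0 := by
    rw [hf.sum_gradient NeZero.one_le, gradient_eq_zero_of_isMinOn hmin, smul_zero]
  have h1 := hf.norm_sum_gradient_sub_le hL σ.s (fun _ => xStar)
  rw [h0, sub_zero, ← hy] at h1
  refine h1.trans ?_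
  refine mul_le_mul_of_nonneg_left ?_ (by positivity)
  refine (wnorm_sub_le_of_momentum hγ hs xStar).trans ?_
  gcongr
  refine (wnorm_one_le_varphiC_mul hφpos).trans ?_
  exact mul_le_mul_of_nonneg_left (wnorm_sub_const_le hφ xStar) (Real.sqrt_nonneg _)

theorem wavg_nextX (hφA : φ' ᵥ* A = φ) :
    wavg φ' (nextX A α β σ) = wavg φ σ.s - α • wavg φ' σ.y +
      β • wavg φ' (fun i => σ.x i - σ.xPrev i) := by
  rw [← wavg_row_wavg hφA, ← wavg_smul, ← wavg_smul, ← wavg_sub, ← wavg_add]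
  rfl

theorem norm_wavg_nextX_sub_le [NeZero n] (hL : 0 < L) (hμ : 0 < μ) (hf : SmoothCosts f L)
    (hconv : StronglyConvexAvg f μ) (hmin : IsMinOn (avgFun f) Set.univ xStar)
    (hφ : φ ∈ stdSimplex ℝ (Fin n)) (hφpos : ∀ i, 0 < φ i) (hφ' : φ' ∈ stdSimplex ℝ (Fin n))
    (hφA : φ' ᵥ* A = φ) (hπ : π ∈ stdSimplex ℝ (Fin n)) (hπpos : ∀ i, 0 < π i)
    (hα : 0 ≤ α) (hαL : α * n * L ≤ 2) (hβ : 0 ≤ β) (hγ : 0 ≤ γ)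
    (hs : ∀ i, σ.s i = σ.x i + γ • (σ.x i - σ.xPrev i))
    (hy : ∑ i, σ.y i = ∑ i, gradient (f i) (σ.s i)) :
    ‖wavg φ' (nextX A α β σ) - xStar‖ ≤ qC μ L α π * ‖wavg φ σ.x - xStar‖ +
      α * L * √(n : ℝ) * varphiC φ * consErr σ.x φ + α * trackErr σ.y π +
      (β + γ * (1 + α * L * √(n : ℝ))) * wnorm 1 (fun i => σ.x i - σ.xPrev i) := by
  set Δ : Fin n → EuclideanSpace ℝ (Fin p) := fun i => σ.x i - σ.xPrev i with hΔ
  set xh := wavg φ σ.x with hxh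
  set θ := ∑ i, φ' i * π i with hθ
  obtain ⟨hθ1, hθ2⟩ := dotProduct_stdSimplex_bounds hφ' hπ
  rw [← hθ] at hθ1 hθ2
  have hm : 0 < vmin π := vmin_pos hπpos
  have hθ0 : 0 ≤ θ := hm.le.trans hθ1
  have hθle : θ ≤ 1 := by
    rw [← hφ'.2]
    exact Finset.sum_le_sum fun i _ =>
      mul_le_of_le_one_right (hφ'.1 i) (le_one_of_mem_stdSimplex hπ i)
  set Y := ∑ i, σ.y i with hY
  set T := wavg φ' (fun i => π i • ((π i)⁻¹ • σ.y i - Y)) with hT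
  set R := ∑ i, gradient (f i) (σ.s i) - ∑ i, gradient (f i) xh with hR
  have hyavg : wavg φ' σ.y = T + θ • Y := by
    rw [hθ, Finset.sum_smul, hT, wavg, wavg, ← Finset.sum_add_distrib]
    refine Finset.sum_congr rfl fun i _ => ?_
    rw [smul_sub, smul_smul (π i), mul_inv_cancel₀ (hπpos i).ne', one_smul, smul_sub, smul_smul,
      sub_add_cancel]
  have hsavg : wavg φ σ.s = xh + γ • wavg φ Δ := by
    rw [hxh, ← wavg_smul, ← wavg_add]
    congr 1
    ext1 i
    exact hs i
  have hYR : Y = (n : ℝ) • gradient (avgFun f) xh + R := by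
    rw [← hf.sum_gradient NeZero.one_le, hR, ← hy]
    abel
  -- Exact gradient step from the mean, plus four errors: gradients taken at `s` instead of the
  -- mean, two momentum terms, and tracking.
  have e : wavg φ' (nextX A α β σ) - xStar =
      ((xh - xStar) - (α * θ * n) • (gradient (avgFun f) xh - gradient (avgFun f) xStar)) -
        (α * θ) • R + γ • wavg φ Δ - α • T + β • wavg φ' Δ := by
    rw [wavg_nextX hφA, hyavg, hsavg, hYR, gradient_eq_zero_of_isMinOn hmin]
    module
  have hstep : ‖(xh - xStar) - (α * θ * n) •
      (gradient (avgFun f) xh - gradient (avgFun f) xStar)‖ ≤ qC μ L α π * ‖xh - xStar‖ := by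
    rcases eq_or_ne xh xStar with h | h
    · simp [h]
    have hLip := hf.norm_gradient_avgFun_sub_le NeZero.one_le
    have hμL := le_of_strongly_monotone h (hLip _ _) (hconv xh xStar)
    refine (norm_gradient_step_le hf.differentiable_avgFun hLip hconv (by positivity) _ _).trans ?_
    exact mul_le_mul_of_nonneg_right
      (max_abs_one_sub_le_qC hμ.le hμL hα hαL hm.le hθ1 hθ2) (norm_nonneg _)
  have hRle : ‖(α * θ) • R‖ ≤
      α * (L * √(n : ℝ) * (varphiC φ * consErr σ.x φ + γ * wnorm 1 Δ)) := by
    rw [norm_smul, Real.norm_of_nonneg (by positivity)]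
    refine mul_le_mul (mul_le_of_le_one_right hα hθle) ?_ (norm_nonneg _) hα
    refine (hf.norm_sum_gradient_sub_le hL.le σ.s fun _ => xh).trans ?_
    refine mul_le_mul_of_nonneg_left ?_ (by positivity)
    refine (wnorm_sub_le_of_momentum hγ hs xh).trans ?_
    gcongr
    exact wnorm_one_le_varphiC_mul hφpos
  have hTle : ‖α • T‖ ≤ α * trackErr σ.y π := by
    rw [norm_smul, Real.norm_of_nonneg hα]
    gcongr
    exact (norm_wavg_le_wnorm hφ').trans
      (wnorm_smul_le_wnorm (le_one_of_mem_stdSimplex hφ') hπ _)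
  have hγle : ‖γ • wavg φ Δ‖ ≤ γ * wnorm 1 Δ := by
    rw [norm_smul, Real.norm_of_nonneg hγ]
    gcongr
    exact norm_wavg_le_of_norm_le hφ norm_le_wnorm_one
  have hβle : ‖β • wavg φ' Δ‖ ≤ β * wnorm 1 Δ := by
    rw [norm_smul, Real.norm_of_nonneg hβ]
    gcongr
    exact norm_wavg_le_of_norm_le hφ' norm_le_wnorm_one
  rw [e]
  refine (norm_add_le _ _).trans ?_
  refine (add_le_add_left (norm_sub_le _ _) _).trans ?_
  refine (add_le_add_left (add_le_add_left (norm_add_le _ _) _) _).trans ?_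
  refine (add_le_add_left (add_le_add_left (add_le_add_left (norm_sub_le _ _) _) _) _).trans ?_
  linarith

theorem consErr_nextX_le [NeZero n] (hL : 0 ≤ L) (hf : SmoothCosts f L)
    (hmin : IsMinOn (avgFun f) Set.univ xStar)
    (hφ : φ ∈ stdSimplex ℝ (Fin n)) (hφpos : ∀ i, 0 < φ i) (hφ' : φ' ∈ stdSimplex ℝ (Fin n))
    (hA : ∀ z : Fin n → EuclideanSpace ℝ (Fin p),
      consErr (fun i => wavg (A i) z) φ' ≤ cC G a φ φ' * consErr z φ)
    (hπ : π ∈ stdSimplex ℝ (Fin n)) (hπpos : ∀ i, 0 < π i)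
    (hα : 0 ≤ α) (hβ : 0 ≤ β) (hγ : 0 ≤ γ)
    (hs : ∀ i, σ.s i = σ.x i + γ • (σ.x i - σ.xPrev i))
    (hy : ∑ i, σ.y i = ∑ i, gradient (f i) (σ.s i)) :
    consErr (nextX A α β σ) φ' ≤
      α * L * √(n : ℝ) * varphiC φ * ‖wavg φ σ.x - xStar‖ +
      (cC G a φ φ' + α * L * √(n : ℝ) * varphiC φ) * consErr σ.x φ + α * trackErr σ.y π +
      (β + γ * (cC G a φ φ' + α * L * √(n : ℝ))) * wnorm 1 (fun i => σ.x i - σ.xPrev i) := by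
  set Δ : Fin n → EuclideanSpace ℝ (Fin p) := fun i => σ.x i - σ.xPrev i with hΔ
  have hΔle : ∀ {w : Fin n → ℝ}, w ∈ stdSimplex ℝ (Fin n) → consErr Δ w ≤ wnorm 1 Δ := fun hw =>
    (consErr_le_wnorm hw).trans (wnorm_le_of_forall_norm_le hw wnorm_nonneg norm_le_wnorm_one)
  have h1 : consErr (nextX A α β σ) φ' ≤ consErr (fun i => wavg (A i) σ.s) φ' +
      α * consErr σ.y φ' + β * consErr Δ φ' := by
    refine (consErr_add_le (z := fun i => wavg (A i) σ.s - α • σ.y i) (u := fun i => β • Δ i)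
      hφ'.1).trans ?_
    rw [consErr_smul, abs_of_nonneg hβ]
    gcongr
    refine (consErr_sub_le hφ'.1).trans ?_
    rw [consErr_smul, abs_of_nonneg hα]
  have h2 : consErr σ.s φ ≤ consErr σ.x φ + γ * wnorm 1 Δ := by
    rw [show σ.s = fun i => σ.x i + γ • Δ i from funext hs]
    refine (consErr_add_le hφ.1).trans ?_
    rw [consErr_smul, abs_of_nonneg hγ]
    gcongr
    exact hΔle hφ
  have h3 : consErr σ.y φ' ≤ trackErr σ.y π + ‖∑ i, σ.y i‖ := (consErr_le_wnorm hφ').trans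
    (wnorm_le_trackErr_add hφ'.1 (le_one_of_mem_stdSimplex hφ') hπ hπpos _)
  have h4 := (hA σ.s).trans (mul_le_mul_of_nonneg_left h2 (Real.sqrt_nonneg _))
  have h5 := mul_le_mul_of_nonneg_left
    (h3.trans (add_le_add_right (norm_sum_tracker_le hL hf hmin hφ hφpos hγ hs hy) _)) hα
  have h6 := mul_le_mul_of_nonneg_left (hΔle hφ') hβ
  linarith

theorem wnorm_nextX_sub_le [NeZero n] (hL : 0 ≤ L) (hf : SmoothCosts f L)
    (hmin : IsMinOn (avgFun f) Set.univ xStar)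
    (hφ : φ ∈ stdSimplex ℝ (Fin n)) (hφpos : ∀ i, 0 < φ i) (hφ'pos : ∀ i, 0 < φ' i)
    (hrow : A ∈ Matrix.rowStochastic ℝ (Fin n)) (hφA : φ' ᵥ* A = φ)
    (hA : ∀ z : Fin n → EuclideanSpace ℝ (Fin p),
      consErr (fun i => wavg (A i) z) φ' ≤ cC G a φ φ' * consErr z φ)
    (hπ : π ∈ stdSimplex ℝ (Fin n)) (hπpos : ∀ i, 0 < π i)
    (hα : 0 ≤ α) (hβ : 0 ≤ β) (hγ : 0 ≤ γ)
    (hs : ∀ i, σ.s i = σ.x i + γ • (σ.x i - σ.xPrev i))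
    (hy : ∑ i, σ.y i = ∑ i, gradient (f i) (σ.s i)) :
    wnorm 1 (fun i => nextX A α β σ i - σ.x i) ≤
      α * L * √(n : ℝ) * varphiC φ * ‖wavg φ σ.x - xStar‖ +
      (cC G a φ φ' * varphiC φ' + varphiC φ + α * L * √(n : ℝ) * varphiC φ) * consErr σ.x φ +
      α * trackErr σ.y π +
      (β + γ * √(n : ℝ) * (1 + α * L)) * wnorm 1 (fun i => σ.x i - σ.xPrev i) := by
  set Δ : Fin n → EuclideanSpace ℝ (Fin p) := fun i => σ.x i - σ.xPrev i with hΔ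
  set xh := wavg φ σ.x with hxh
  -- Both `A x` and `x` are compared with the mean `xh`, which is also the `φ'`-mean of `A x`; hence
  -- the two consensus terms of `m42`, only one of them carrying the factor `c`.
  have e : (fun i => nextX A α β σ i - σ.x i) = fun i =>
      (wavg (A i) σ.x - xh) - (σ.x i - xh) + γ • wavg (A i) Δ - α • σ.y i + β • Δ i := by
    ext1 i
    have : wavg (A i) σ.s = wavg (A i) σ.x + γ • wavg (A i) Δ := by
      rw [← wavg_smul, ← wavg_add]
      congr 1
      ext1 j
      exact hs j
    change wavg (A i) σ.s - α • σ.y i + β • Δ i - σ.x i = _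
    rw [this]
    abel
  have h1 : wnorm 1 (fun i => wavg (A i) σ.x - xh) ≤
      varphiC φ' * (cC G a φ φ' * consErr σ.x φ) := by
    refine (wnorm_one_le_varphiC_mul hφ'pos).trans ?_
    refine mul_le_mul_of_nonneg_left ((le_of_eq ?_).trans (hA σ.x)) (Real.sqrt_nonneg _)
    rw [consErr, wavg_row_wavg hφA]
  have h2 : wnorm 1 (fun i => σ.x i - xh) ≤ varphiC φ * consErr σ.x φ :=
    wnorm_one_le_varphiC_mul hφpos
  have h3 : wnorm 1 (fun i => γ • wavg (A i) Δ) ≤ γ * (√(n : ℝ) * wnorm 1 Δ) := by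
    rw [wnorm_smul, abs_of_nonneg hγ]
    gcongr
    exact wnorm_one_le_of_norm_le wnorm_nonneg fun i =>
      norm_wavg_le_of_norm_le (row_mem_stdSimplex hrow i) norm_le_wnorm_one
  have h4 : wnorm 1 (fun i => α • σ.y i) ≤ α * (trackErr σ.y π + L * √(n : ℝ) *
      (varphiC φ * (‖xh - xStar‖ + consErr σ.x φ) + γ * wnorm 1 Δ)) := by
    rw [wnorm_smul, abs_of_nonneg hα]
    refine mul_le_mul_of_nonneg_left ?_ hα
    exact (wnorm_le_trackErr_add zero_le_one (fun _ => le_rfl) hπ hπpos _).trans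
      (add_le_add_right (norm_sum_tracker_le hL hf hmin hφ hφpos hγ hs hy) _)
  have h5 : wnorm 1 (fun i => β • Δ i) = β * wnorm 1 Δ := by
    rw [wnorm_smul, abs_of_nonneg hβ]
  rw [e]
  refine (wnorm_add_le zero_le_one).trans ?_
  refine (add_le_add_left (wnorm_sub_le zero_le_one) _).trans ?_
  refine (add_le_add_left (add_le_add_left (wnorm_add_le zero_le_one) _) _).trans ?_
  refine (add_le_add_left (add_le_add_left (add_le_add_left
    (wnorm_sub_le zero_le_one) _) _) _).trans ?_
  linarith

theorem trackErr_nextY_le [NeZero n] (hL : 0 ≤ L) (hf : SmoothCosts f L)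
    (hπ' : π' ∈ stdSimplex ℝ (Fin n)) (hπ'pos : ∀ i, 0 < π' i)
    (hB : trackErr (fun i => wavg (B i) σ.y) π' ≤ tauC G b π π' * trackErr σ.y π)
    (hγ : 0 ≤ γ) (hs : ∀ i, σ.s i = σ.x i + γ • (σ.x i - σ.xPrev i)) :
    trackErr (nextY f A B α β γ σ) π' ≤ tauC G b π π' * trackErr σ.y π +
      L * rC π' * ((1 + γ) * wnorm 1 (fun i => nextX A α β σ i - σ.x i) +
        γ * wnorm 1 (fun i => σ.x i - σ.xPrev i)) := by
  have e : nextY f A B α β γ σ = fun i => wavg (B i) σ.y +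
      (gradient (f i) (nextS A α β γ σ i) - gradient (f i) (σ.s i)) := by
    ext1 i
    exact add_sub_assoc _ _ _
  -- The increment of `s` in terms of the new and old increments of `x`; it produces the factors `1
  -- + γ` and `γ` in row 3.
  have e2 : (fun i => nextS A α β γ σ i - σ.s i) = fun i =>
      (1 + γ) • (nextX A α β σ i - σ.x i) - γ • (σ.x i - σ.xPrev i) := by
    ext1 i
    rw [hs i, nextS]
    module
  have hr : 0 ≤ rC π' := add_nonneg (Real.sqrt_nonneg _) (by positivity)
  rw [e]
  refine (trackErr_add_le hπ'pos _ _).trans (add_le_add hB ?_)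
  refine (trackErr_le_rC_mul hπ' hπ'pos _).trans ?_
  rw [mul_comm L, mul_assoc]
  refine mul_le_mul_of_nonneg_left ?_ hr
  refine (hf.wnorm_gradient_sub_le hL _ _).trans ?_
  refine mul_le_mul_of_nonneg_left ?_ hL
  rw [e2]
  refine (wnorm_sub_le zero_le_one).trans ?_
  rw [wnorm_smul, wnorm_smul, abs_of_nonneg hγ, abs_of_nonneg (by linarith)]

end Step

/-! ### Invariants of the iterates -/

section Iterates

variable {n p : ℕ} {f : Fin n → EuclideanSpace ℝ (Fin p) → ℝ}
  {A B : ℕ → Matrix (Fin n) (Fin n) ℝ} {α β γ : ℝ}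
  {xInit x0 s0 : Fin n → EuclideanSpace ℝ (Fin p)}

/-- Gradient tracking: column-stochastic mixing conserves the sum, the gradient increments
telescope, and the initialization of `y` starts the invariant. -/
theorem sum_iter_y (hB : ∀ k, B k ∈ Matrix.colStochastic ℝ (Fin n)) (k : ℕ) :
    ∑ i, (iter f A B α β γ xInit x0 s0 k).y i =
      ∑ i, gradient (f i) ((iter f A B α β γ xInit x0 s0 k).s i) := by
  induction k with
  | zero => rfl
  | succ k ih =>
    simp only [iter, nextY, Finset.sum_sub_distrib, Finset.sum_add_distrib]
    rw [sum_colStochastic_smul (hB k), ih]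
    abel

/-- Definitional after one step; only at `k = 0`, where `s0` is arbitrary, is the extra hypothesis
needed. -/
theorem iter_s_eq {k : ℕ} (hk : 1 ≤ k ∨ ∀ i, s0 i = x0 i + γ • (x0 i - xInit i)) (i : Fin n) :
    (iter f A B α β γ xInit x0 s0 k).s i = (iter f A B α β γ xInit x0 s0 k).x i +
      γ • ((iter f A B α β γ xInit x0 s0 k).x i - (iter f A B α β γ xInit x0 s0 k).xPrev i) := by
  cases k with
  | zero => exact (hk.resolve_left (by simp)) i
  | succ k => rfl

end Iterates

end ABPushPull

/-! ### Assembly of the four rows -/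

theorem mainTheorem2 {n p : ℕ} (hn : 1 ≤ n)
    (G : ℕ → Digraph (Fin n)) (A B : ℕ → Matrix (Fin n) (Fin n) ℝ) (a b : ℝ)
    (hnet : ABPushPull.IsNetwork G A B a b)
    (f : Fin n → EuclideanSpace ℝ (Fin p) → ℝ) (L μ : ℝ) (hL : 0 < L) (hμ : 0 < μ)
    (hf : ABPushPull.SmoothCosts f L) (hconv : ABPushPull.StronglyConvexAvg f μ)
    (xStar : EuclideanSpace ℝ (Fin p))
    (hxStar : IsMinOn (ABPushPull.avgFun f) Set.univ xStar)
    (φ : ℕ → Fin n → ℝ) (hφ : ABPushPull.IsAbsProbSeq A φ)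
    (α β γ : ℝ) (hα : α ∈ Set.Ioo 0 (2 / (n * L))) (hβ : 0 ≤ β) (hγ : 0 ≤ γ)
    (xInit x0 s0 : Fin n → EuclideanSpace ℝ (Fin p))
    (k : ℕ) (hk : 1 ≤ k ∨ ∀ i, s0 i = x0 i + γ • (x0 i - xInit i)) :
    ABPushPull.errVec (ABPushPull.iter f A B α β γ xInit x0 s0 (k + 1))
        (φ (k + 1)) (ABPushPull.piSeq B (k + 1)) xStar ≤
      ABPushPull.stepMatrix G φ (ABPushPull.piSeq B) a b L μ α β γ k *ᵥ
        ABPushPull.errVec (ABPushPull.iter f A B α β γ xInit x0 s0 k)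
          (φ k) (ABPushPull.piSeq B k) xStar := by
  open ABPushPull in
  have : NeZero n := ⟨by omega⟩
  have hαL : α * n * L ≤ 2 := by
    have := (lt_div_iff₀ (by positivity)).1 hα.2
    linarith
  have hs := iter_s_eq (f := f) (A := A) (B := B) (α := α) (β := β) hk
  have hy := sum_iter_y (f := f) (A := A) (α := α) (β := β) (γ := γ) (xInit := xInit) (x0 := x0)
    (s0 := s0) hnet.col k
  have hφpos := hφ.pos hnet
  have hπpos := piSeq_pos hnet
  have hπ := piSeq_mem_stdSimplex hn hnet
  have hA : ∀ z : Fin n → EuclideanSpace ℝ (Fin p), _ :=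
    consErr_mul_le (hnet.strong k) (hnet.row k) (hnet.alignA k) (hφ.1 k) (hφ.1 (k + 1)) (hφ.2 k)
      hnet.a_pos (hnet.a_le k)
  have hB := trackErr_mul_le (hnet.strong k) (hnet.col k) (hnet.alignB k) (hπ k) (hπ (k + 1))
    (hπpos k) (hπpos (k + 1)) rfl hnet.b_pos (hnet.b_le k)
    (iter f A B α β γ xInit x0 s0 k).y
  have row1 := norm_wavg_nextX_sub_le hL hμ hf hconv hxStar (hφ.1 k) (hφpos k) (hφ.1 (k + 1))
    (hφ.2 k) (hπ k) (hπpos k) hα.1.le hαL hβ hγ hs hy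
  have row2 := consErr_nextX_le hL.le hf hxStar (hφ.1 k) (hφpos k) (hφ.1 (k + 1)) hA
    (hπ k) (hπpos k) hα.1.le hβ hγ hs hy
  have row4 := wnorm_nextX_sub_le hL.le hf hxStar (hφ.1 k) (hφpos k) (hφpos (k + 1))
    (hnet.row k) (hφ.2 k) hA (hπ k) (hπpos k) hα.1.le hβ hγ hs hy
  have row3 := trackErr_nextY_le (A := A k) (α := α) (β := β) hL.le hf (hπ (k + 1))
    (hπpos (k + 1)) hB hγ hs
  have hr : 0 ≤ L * rC (piSeq B (k + 1)) * (1 + γ) := by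
    have : 0 ≤ rC (piSeq B (k + 1)) := add_nonneg (Real.sqrt_nonneg _) (by positivity)
    positivity
  -- Row 3 still contains the new increment of `x`; scaling row 4 by `L r (1 + γ)` eliminates it.
  have row3' := mul_le_mul_of_nonneg_left row4 hr
  intro i
  fin_cases i <;>
    simp only [errVec, stepMatrix, matM, Matrix.mulVec, dotProduct, Fin.sum_univ_four,
      Matrix.of_apply, Matrix.cons_val, Fin.zero_eta, Fin.mk_one, Fin.reduceFinMk, iter]
  · exact row1
  · exact row2
  · linarith
  · exact row4
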